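/- Let $X$ be a finite connected quantum graph: $X$ is the union of a finite non-empty set $\mathcal E$ of edges, each edge $e$ being a compact interval $[0,\ell_e]$ with $0<\ell_e<\infty$, whose ends are glued at the points of a finite vertex set $\mathcal V$ (loops and multiple edges are allowed), any two vertices being joined by a path of edges. Let $\mathrm{d}x$ be the measure on $X$ that is Lebesgue measure on each edge, and $|X|=\sum_e \ell_e$. Let $H_0 f=-f''$ in $L^2(X,\mathrm{d}x)$ with Kirchhoff vertex conditions: $\mathrm{Dom}(H_0)$ is the set of all $f\in L^2(X,\mathrm dx)$ that have a continuous version on $X$ whose restriction to each edge $e$ lies in $W^{2,2}(e)$ and whose outgoing derivatives along the edge ends at $v$ sum to zero, for each vertex $v$. Then $H_0$ is a non-negative self-adjoint operator with discrete spectrum: there is a complete orthonormal system of eigenfunctions $\phi_1,\phi_2,\dots$ with eigenvalues $\lambda_1\le\lambda_2\le\cdots\to\infty$. Moreover: (H1) The operators $\mathrm e^{-H_0t}$, $t>0$, have a non-negative integral kernel $K_0(t,x,y)$ which is continuous on $(0,\infty)\times X\times X$, that is, $(\mathrm e^{-H_0t}f)(x)=\int_X K_0(t,x,y)f(y)\,\mathrm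 dy$ for almost every $x$, for all $t>0$ and $f\in L^2(X,\mathrm dx)$. (H2) (with $d=1$) There is a constant $c>0$ such that $0\le K_0(t,x,x)\le c\,t^{-1/2}$ for all $0<t<1$ and $x\in X$. (H4) The smallest eigenvalue $\lambda_1$ of $H_0$ equals $0$ and has multiplicity $1$; its eigenfunctions are the non-zero constants, and one may take $\phi_1=|X|^{-1/2}$. -/

import Mathlib

open Set Filter Topology MeasureTheory

noncomputable section

/-! ## Abstract notions: eigenspaces, semigroups, heat kernels, discrete spectrum -/

/-- The eigenspace `{f ∈ Dom A | A f = z f}` of a partially defined operator `A`. -/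
def eigenspaceOf {F : Type*} [AddCommGroup F] [Module ℂ F] (A : F →ₗ.[ℂ] F) (z : ℂ) :
    Submodule ℂ F :=
  A.graph.comap (LinearMap.prod LinearMap.id (z • LinearMap.id))

theorem mem_eigenspaceOf {F : Type*} [AddCommGroup F] [Module ℂ F] (A : F →ₗ.[ℂ] F) (z : ℂ)
    (f : F) : f ∈ eigenspaceOf A z ↔ ∃ h : f ∈ A.domain, A ⟨f, h⟩ = z • f := by
  simp [eigenspaceOf, LinearPMap.mem_graph_iff]

/-- `T t = exp (t A)` for `t ≥ 0`: the family `(T t)_{t ≥ 0}` is a strongly continuous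
one-parameter semigroup of bounded operators whose infinitesimal generator, with its full domain,
is `A`. The values of `T` at negative times are irrelevant. -/
structure IsSemigroupWithGenerator {F : Type*} [NormedAddCommGroup F] [NormedSpace ℂ F]
    (T : ℝ → F →L[ℂ] F) (A : F →ₗ.[ℂ] F) : Prop where
  map_zero : T 0 = ContinuousLinearMap.id ℂ F
  map_add : ∀ s t : ℝ, 0 ≤ s → 0 ≤ t → T (s + t) = (T s).comp (T t)
  strongly_continuous : ∀ f : F, ContinuousOn (fun t => T t f) (Ici 0)
  generator : ∀ f g : F, (f, g) ∈ A.graph ↔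
    Tendsto (fun t : ℝ => t⁻¹ • (T t f - f)) (𝓝[>] 0) (𝓝 g)

/-- `K` is an integral kernel of `exp (-H t)`, `t > 0`, on `L²(X, μ)`. -/
def IsHeatKernel {X : Type*} [MeasurableSpace X] (μ : Measure X)
    (H : Lp ℂ 2 μ →ₗ.[ℂ] Lp ℂ 2 μ) (K : ℝ → X → X → ℝ) : Prop :=
  ∃ T : ℝ → Lp ℂ 2 μ →L[ℂ] Lp ℂ 2 μ, IsSemigroupWithGenerator T (-H) ∧
    ∀ t : ℝ, 0 < t → ∀ f : Lp ℂ 2 μ, T t f =ᵐ[μ] fun x => ∫ y, (K t x y : ℂ) * f y ∂μ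

/-- `φ 0, φ 1, …` is a complete orthonormal system of eigenvectors of `H` in `L²(X, μ)`, whose
eigenvalues `lam 0 ≤ lam 1 ≤ …` are real and tend to infinity; hence `lam` lists the eigenvalues
in increasing order, repeated according to multiplicity. -/
structure IsDiscreteSpectrum {F : Type*} [NormedAddCommGroup F] [InnerProductSpace ℂ F]
    (H : F →ₗ.[ℂ] F) (lam : ℕ → ℝ) (φ : HilbertBasis ℕ ℂ F) : Prop where
  monotone : Monotone lam
  tendsto : Tendsto lam atTop atTop
  eigenvector : ∀ n, φ n ∈ eigenspaceOf H (lam n : ℂ)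

/-! ## Metric graphs -/

/-- A metric graph with vertices `V` and edges `E`: the edge `e` is the compact interval
`[0, len e]`, whose left and right ends are attached to the vertices `src e` and `tgt e`
(the choice of orientation is immaterial; loops and multiple edges are allowed). -/
structure QuantumGraph (V E : Type*) where
  src : E → V
  tgt : E → V
  len : E → ℝ
  len_pos : ∀ e, 0 < len e

namespace QuantumGraph

variable {V E : Type*} (G : QuantumGraph V E)

/-- Any two vertices are joined by a path of edges, traversed in either direction. -/
def Connected : Prop :=
  ∀ v w : V, Relation.EqvGen (fun a b => ∃ e, G.src e = a ∧ G.tgt e = b) v w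

/-- The disjoint union of the closed edges. -/
abbrev Edges : Type _ := Σ e : E, Icc (0 : ℝ) (G.len e)

/-- `p` is an end of an edge, attached to the vertex `v`. -/
def IsEndAt (p : G.Edges) (v : V) : Prop :=
  ((p.2 : ℝ) = 0 ∧ G.src p.1 = v) ∨ ((p.2 : ℝ) = G.len p.1 ∧ G.tgt p.1 = v)

/-- The space `X`: the union of the closed edges, any two ends attached to the same vertex being
identified. -/
def Space : Type _ :=
  Quot (fun p q : G.Edges => ∃ v, G.IsEndAt p v ∧ G.IsEndAt q v)

instance : TopologicalSpace G.Space :=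
  inferInstanceAs (TopologicalSpace (Quot _))

instance : MeasurableSpace G.Space := borel _

instance : BorelSpace G.Space := ⟨rfl⟩

/-- The point of `X` with coordinate `x ∈ [0, len e]` on the edge `e`
(reals outside `[0, len e]` are moved to the nearest end). -/
def pt (e : E) (x : ℝ) : G.Space :=
  Quot.mk _ ⟨e, projIcc 0 (G.len e) (G.len_pos e).le x⟩

theorem continuous_pt (e : E) : Continuous (G.pt e) :=
  continuous_quot_mk.comp (continuous_sigmaMk.comp continuous_projIcc)

/-- The measure `dx` on `X`: Lebesgue measure on each edge. -/
def vol : Measure G.Space :=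
  Measure.sum fun e => (volume.restrict (Icc 0 (G.len e))).map (G.pt e)

/-- The Hilbert space `L²(X, dx)`. -/
abbrev L2 : Type _ := Lp ℂ 2 G.vol

theorem map_pt_le_vol (e : E) :
    (volume.restrict (Icc 0 (G.len e))).map (G.pt e) ≤ G.vol :=
  Measure.le_sum (fun e => (volume.restrict (Icc 0 (G.len e))).map (G.pt e)) e

theorem ae_pt {p : G.Space → Prop} (h : ∀ᵐ x ∂G.vol, p x) (e : E) :
    ∀ᵐ s ∂volume.restrict (Icc 0 (G.len e)), p (G.pt e s) :=
  ae_of_ae_map (G.continuous_pt e).aemeasurable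
    ((Measure.absolutelyContinuous_of_le (G.map_pt_le_vol e)).ae_le h)

theorem integrableOn_pt (h : G.L2) (e : E) :
    IntegrableOn (fun s => h (G.pt e s)) (Icc 0 (G.len e)) := by
  have h1 : MemLp h 2 ((volume.restrict (Icc 0 (G.len e))).map (G.pt e)) :=
    (Lp.memLp h).mono_measure (G.map_pt_le_vol e)
  have h2 := h1.comp_of_map (G.continuous_pt e).aemeasurable
  exact h2.integrable (by norm_num)

theorem intervalIntegrable_pt (h : G.L2) (e : E) {x : ℝ} (hx : x ∈ Icc 0 (G.len e)) :
    IntervalIntegrable (fun s => h (G.pt e s)) volume 0 x := by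
  rw [intervalIntegrable_iff_integrableOn_Icc_of_le hx.1]
  exact (G.integrableOn_pt h e).mono_set (Icc_subset_Icc_right hx.2)

theorem integral_pt_congr {g : G.Space → ℂ} {h : G.Space → ℂ} (hgh : g =ᵐ[G.vol] h) (e : E)
    {x : ℝ} (hx : x ∈ Icc 0 (G.len e)) :
    ∫ s in (0 : ℝ)..x, g (G.pt e s) = ∫ s in (0 : ℝ)..x, h (G.pt e s) := by
  have h1 := (ae_restrict_iff' measurableSet_Icc).1 (G.ae_pt hgh e)
  refine intervalIntegral.integral_congr_ae ?_
  filter_upwards [h1] with s hs hsx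
  rw [uIoc_of_le hx.1] at hsx
  exact hs ⟨hsx.1.le, hsx.2.trans hx.2⟩

variable [Fintype E]

open Classical in
/-- The sum over the edge ends at `v` of the outgoing derivatives, if `du e` is the derivative
along the edge `e` with respect to the coordinate in `[0, len e]`. -/
def outgoingSum (du : E → ℝ → ℂ) (v : V) : ℂ :=
  ∑ e, ((if G.src e = v then du e 0 else 0) - (if G.tgt e = v then du e (G.len e) else 0))

/-- `f` lies in the domain of `H₀` and `H₀ f = h`. That is: `f` has a continuous version `u` on
`X`; on each closed edge `u` is continuously differentiable, and `u'` is absolutely continuous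
with `-u'' = h ∈ L²` almost everywhere (so that `u` is in `W^{2,2}` of the edge); the outgoing
derivatives of `u` sum to zero at each vertex. -/
def IsKirchhoffPair (f h : G.L2) : Prop :=
  ∃ (u : C(G.Space, ℂ)) (du : E → ℝ → ℂ),
    f =ᵐ[G.vol] u ∧
    (∀ e, ∀ x ∈ Icc 0 (G.len e),
      HasDerivWithinAt (fun s => u (G.pt e s)) (du e x) (Icc 0 (G.len e)) x) ∧
    (∀ e, ∀ x ∈ Icc 0 (G.len e), du e x = du e 0 - ∫ s in (0 : ℝ)..x, h (G.pt e s)) ∧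
    ∀ v, G.outgoingSum du v = 0

/-- The graph of `H₀`. -/
def kirchhoffGraph : Submodule ℂ (G.L2 × G.L2) where
  carrier := {p | G.IsKirchhoffPair p.1 p.2}
  zero_mem' := by
    refine ⟨0, 0, Lp.coeFn_zero _ _ _, ?_, ?_, ?_⟩
    · intro e x _
      simpa using hasDerivWithinAt_const x (Icc 0 (G.len e)) (0 : ℂ)
    · intro e x hx
      have := G.integral_pt_congr (Lp.coeFn_zero ℂ 2 G.vol) e hx
      simp only [Prod.snd_zero]
      rw [this]
      simp
    · intro v
      simp [outgoingSum]
  add_mem' := by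
    rintro ⟨f, h⟩ ⟨f', h'⟩ ⟨u, du, h1, h2, h3, h4⟩ ⟨u', du', h1', h2', h3', h4'⟩
    refine ⟨u + u', du + du', ?_, ?_, ?_, ?_⟩
    · exact (Lp.coeFn_add f f').trans (h1.add h1')
    · intro e x hx
      exact (h2 e x hx).add (h2' e x hx)
    · intro e x hx
      have := G.integral_pt_congr (Lp.coeFn_add h h') e hx
      simp only [Prod.mk_add_mk, Pi.add_apply] at this ⊢
      rw [this, intervalIntegral.integral_add (G.intervalIntegrable_pt h e hx)
        (G.intervalIntegrable_pt h' e hx), h3 e x hx, h3' e x hx]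
      ring
    · intro v
      have e1 : G.outgoingSum (du + du') v = G.outgoingSum du v + G.outgoingSum du' v := by
        simp only [outgoingSum, ← Finset.sum_add_distrib]
        refine Finset.sum_congr rfl fun e _ => ?_
        simp only [Pi.add_apply]
        split_ifs <;> ring
      rw [e1, h4, h4', add_zero]
  smul_mem' := by
    rintro c ⟨f, h⟩ ⟨u, du, h1, h2, h3, h4⟩
    refine ⟨c • u, c • du, ?_, ?_, ?_, ?_⟩
    · exact (Lp.coeFn_smul c f).trans (h1.const_smul c)
    · intro e x hx
      exact (h2 e x hx).const_smul c
    · intro e x hx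
      have := G.integral_pt_congr (Lp.coeFn_smul c h) e hx
      simp only [Prod.smul_mk, Pi.smul_apply] at this ⊢
      rw [this, intervalIntegral.integral_smul, h3 e x hx, smul_sub]
    · intro v
      have e1 : G.outgoingSum (c • du) v = c * G.outgoingSum du v := by
        simp only [outgoingSum, Finset.mul_sum]
        refine Finset.sum_congr rfl fun e _ => ?_
        simp only [Pi.smul_apply, smul_eq_mul]
        split_ifs <;> ring
      rw [e1, h4, mul_zero]

/-- `H₀ f` is determined by `f`. -/
theorem kirchhoffGraph_single_valued (p : G.L2 × G.L2) (hp : p ∈ G.kirchhoffGraph)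
    (h0 : p.1 = 0) : p.2 = 0 := by
  obtain ⟨f, h⟩ := p
  obtain ⟨u, du, h1, h2, h3, -⟩ := hp
  simp only at h0 h1 h3 ⊢
  subst h0
  have hu : ∀ᵐ x ∂G.vol, u x = 0 := by
    filter_upwards [h1, Lp.coeFn_zero ℂ 2 G.vol] with x hx hx'
    rw [← hx, hx']; rfl
  have hue : ∀ e, ∀ x ∈ Icc 0 (G.len e), u (G.pt e x) = 0 := by
    intro e
    have := Measure.eqOn_Icc_of_ae_eq volume (G.len_pos e).ne
      (f := fun s => u (G.pt e s)) (g := fun _ => 0) (G.ae_pt hu e)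
      (u.continuous.comp (G.continuous_pt e)).continuousOn continuousOn_const
    exact this
  have hdu : ∀ e, ∀ x ∈ Icc 0 (G.len e), du e x = 0 := by
    intro e x hx
    refine (uniqueDiffOn_Icc (G.len_pos e) x hx).eq_deriv _ (h2 e x hx) ?_
    exact (hasDerivWithinAt_const x _ (0 : ℂ)).congr (hue e) (hue e x hx)
  have hint : ∀ e, ∀ x ∈ Icc 0 (G.len e), ∫ s in (0 : ℝ)..x, h (G.pt e s) = 0 := by
    intro e x hx
    have := h3 e x hx
    rw [hdu e x hx, hdu e 0 ⟨le_rfl, (G.len_pos e).le⟩, zero_sub, eq_comm, neg_eq_zero] at this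
    exact this
  rw [Lp.eq_zero_iff_ae_eq_zero]
  have hmeas : MeasurableSet {x | h x = 0} :=
    (Lp.stronglyMeasurable h).measurable (measurableSet_singleton 0)
  refine (Measure.ae_sum_iff' hmeas).2 fun e => ?_
  refine (ae_map_iff (G.continuous_pt e).aemeasurable hmeas).2 ?_
  have hI := G.intervalIntegrable_pt h e (right_mem_Icc.2 (G.len_pos e).le)
  have hD := hI.ae_hasDerivAt_integral
  rw [← restrict_Ioo_eq_restrict_Icc, ae_restrict_iff' measurableSet_Ioo]
  filter_upwards [hD] with x hx hx'
  have hxI : x ∈ Icc 0 (G.len e) := Ioo_subset_Icc_self hx'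
  have hd := hx (by rwa [uIcc_of_le (G.len_pos e).le]) 0
    (by rw [uIcc_of_le (G.len_pos e).le]; exact left_mem_Icc.2 (G.len_pos e).le)
  refine hd.unique ?_
  refine (hasDerivAt_const x (0 : ℂ)).congr_of_eventuallyEq ?_
  filter_upwards [Ioo_mem_nhds hx'.1 hx'.2] with y hy
  exact hint e y (Ioo_subset_Icc_self hy)

/-- The operator `H₀ = -d²/dx²` on `L²(X, dx)` with Kirchhoff conditions at all vertices. -/
def H₀ : G.L2 →ₗ.[ℂ] G.L2 :=
  G.kirchhoffGraph.toLinearPMap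

theorem mem_graph_H₀ (f h : G.L2) : (f, h) ∈ G.H₀.graph ↔ G.IsKirchhoffPair f h := by
  rw [H₀, Submodule.toLinearPMap_graph_eq _ G.kirchhoffGraph_single_valued]
  rfl

end QuantumGraph

end

open Set Filter Topology MeasureTheory

noncomputable section

/-! ## Operators that are diagonal in a Hilbert basis -/

section Diagonal

variable {F : Type*} [NormedAddCommGroup F] [InnerProductSpace ℂ F]

/-! Everything rests on showing that `H₀` is diagonal, with its maximal domain, in a Hilbert basis
(`exists_isDiagonalIn`). Once this is known, self-adjointness, the location of the spectrum and the
generation of the semigroup are computations with coefficients.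

Diagonalization: integration by parts on the edges, with boundary terms cancelled by continuity and
the Kirchhoff conditions (`IsKirchhoffRep.green`), makes `H₀` symmetric and non-negative; vanishing
energy and connectedness leave only constants in the kernel. For `h` orthogonal to the constants,
`-u'' = h` is integrated explicitly on each edge, and matching at the vertices becomes a Poisson
equation on the finite combinatorial graph (`exists_mem_graph`). Energy bounds and Arzelà–Ascoli
make the inverse on the complement of the constants compact, so the spectral theorem applies.

Heat kernel: a Sobolev inequality with a free parameter `ε`, bounding `‖u x‖ ^ 2` by the `L²` norm
and the energy, is applied to finite combinations of eigenfunctions. It gives a pointwise bound for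
`∑ exp (-λₙ t) |Φₙ x|²` (`IsEigenSystem.sum_exp_le`). Integrating it over the graph gives
summability of `exp (-λₙ t)`, hence locally uniform convergence of the eigenfunction expansion for
`t > 0`, and the choice `ε = t ^ (-1/2)` gives the on-diagonal estimate.

Positivity: a minimum principle for `-u'' + a u` shows that the resolvents preserve closed
half-space cones in `L²`; Euler's formula `(1 + tA/k)⁻ᵏ → exp (-tA)` passes this to the semigroup
(`IsDiagonalIn.expNeg_mem`), and continuity transfers it to the kernel pointwise. -/

theorem HilbertBasis.hasSum_norm_sq_repr {ι : Type*} (b : HilbertBasis ι ℂ F) (f : F) :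
    HasSum (fun n => ‖b.repr f n‖ ^ 2) (‖f‖ ^ 2) := by
  have h := lp.hasSum_norm (p := 2) (by norm_num) (b.repr f)
  simpa using h

theorem HilbertBasis.ext_repr {ι : Type*} (b : HilbertBasis ι ℂ F) {f g : F}
    (h : ∀ n, b.repr f n = b.repr g n) : f = g :=
  b.repr.injective (lp.ext (funext h))

/-- Dominated convergence for the coefficients with respect to a Hilbert basis. -/
theorem HilbertBasis.tendsto_of_dominated {ι α : Type*} (b : HilbertBasis ι ℂ F) {l : Filter α}
    (u : α → F) (g f : F) (C : ℝ)
    (hlim : ∀ n, Tendsto (fun a => b.repr (u a) n) l (𝓝 (b.repr g n)))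
    (hbound : ∀ᶠ a in l, ∀ n, ‖b.repr (u a - g) n‖ ≤ C * ‖b.repr f n‖) :
    Tendsto u l (𝓝 g) := by
  have h1 : Tendsto (fun a => ∑' n, ‖b.repr (u a - g) n‖ ^ 2) l (𝓝 (∑' _ : ι, (0 : ℝ))) := by
    refine tendsto_tsum_of_dominated_convergence (bound := fun n => C ^ 2 * ‖b.repr f n‖ ^ 2)
      ((b.hasSum_norm_sq_repr f).summable.mul_left _) (fun n => ?_) ?_
    · have : Tendsto (fun a => b.repr (u a) n - b.repr g n) l (𝓝 0) := by
        simpa using (hlim n).sub_const (b.repr g n)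
      simpa using this.norm.pow 2
    · filter_upwards [hbound] with a ha n
      rw [Real.norm_of_nonneg (by positivity), ← mul_pow]
      gcongr
      exact ha n
  rw [tendsto_iff_norm_sub_tendsto_zero]
  have h2 : Tendsto (fun a => ‖u a - g‖ ^ 2) l (𝓝 0) := by
    refine Tendsto.congr (fun a => (b.hasSum_norm_sq_repr (u a - g)).tsum_eq) ?_
    simpa using h1
  simpa using h2.sqrt

/-- The contraction with diagonal entries `m n` in the Hilbert basis `b`. -/
def HilbertBasis.diagonal (b : HilbertBasis ℕ ℂ F) (m : ℕ → ℝ) (hm : ∀ n, |m n| ≤ 1) :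
    F →L[ℂ] F :=
  have hle : ∀ f n, ‖(m n : ℂ) * b.repr f n‖ ≤ ‖b.repr f n‖ := fun f n => by
    rw [norm_mul, Complex.norm_real]
    exact mul_le_of_le_one_left (norm_nonneg _) (hm n)
  have hmem : ∀ f, Memℓp (fun n => (m n : ℂ) * b.repr f n) 2 := fun f => by
    refine memℓp_gen ?_
    refine Summable.of_nonneg_of_le (fun n => by positivity) (fun n => ?_)
      (b.hasSum_norm_sq_repr f).summable
    simpa using pow_le_pow_left₀ (norm_nonneg _) (hle f n) 2
  LinearMap.mkContinuous
    { toFun := fun f => b.repr.symm ⟨_, hmem f⟩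
      map_add' := fun f g => b.ext_repr fun n => by
        simp only [map_add, LinearIsometryEquiv.apply_symm_apply, lp.coeFn_add, Pi.add_apply,
          mul_add]
      map_smul' := fun c f => b.ext_repr fun n => by simp; ring } 1 (fun f => by
    rw [one_mul]
    refine abs_le_of_sq_le_sq' ?_ (norm_nonneg _) |>.2
    refine hasSum_le (fun n => ?_) (b.hasSum_norm_sq_repr _) (b.hasSum_norm_sq_repr f)
    simpa using pow_le_pow_left₀ (norm_nonneg _) (hle f n) 2)

@[simp]
theorem HilbertBasis.repr_diagonal (b : HilbertBasis ℕ ℂ F) (m : ℕ → ℝ) (hm : ∀ n, |m n| ≤ 1)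
    (f : F) (n : ℕ) : b.repr (b.diagonal m hm f) n = m n * b.repr f n := by
  simp [HilbertBasis.diagonal]

/-- `A` acts diagonally, with its maximal domain, in the Hilbert basis `b`. -/
def IsDiagonalIn (A : F →ₗ.[ℂ] F) (lam : ℕ → ℝ) (b : HilbertBasis ℕ ℂ F) : Prop :=
  ∀ f g : F, (f, g) ∈ A.graph ↔ ∀ n, b.repr g n = lam n * b.repr f n

variable {A : F →ₗ.[ℂ] F} {lam : ℕ → ℝ} {b : HilbertBasis ℕ ℂ F}

theorem IsDiagonalIn.repr_apply (h : IsDiagonalIn A lam b) (f : A.domain) (n : ℕ) :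
    b.repr (A f) n = lam n * b.repr f n :=
  (h f (A f)).1 (A.mem_graph f) n

theorem IsDiagonalIn.basis_mem_graph (h : IsDiagonalIn A lam b) (n : ℕ) :
    (b n, (lam n : ℂ) • b n) ∈ A.graph := by
  classical
  refine (h _ _).2 fun k => ?_
  rw [map_smul, b.repr_self]
  simp only [lp.coeFn_smul, Pi.smul_apply, smul_eq_mul]
  rcases eq_or_ne k n with rfl | hk
  · simp
  · simp [lp.single_apply, hk]

theorem IsDiagonalIn.mem_eigenspaceOf_basis (h : IsDiagonalIn A lam b) (n : ℕ) :
    b n ∈ eigenspaceOf A (lam n : ℂ) :=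
  h.basis_mem_graph n

theorem IsDiagonalIn.dense_domain (h : IsDiagonalIn A lam b) : Dense (A.domain : Set F) := by
  have h1 : Submodule.span ℂ (range b) ≤ A.domain := by
    rw [Submodule.span_le]
    rintro _ ⟨n, rfl⟩
    exact LinearPMap.mem_domain_of_mem_graph (h.basis_mem_graph n)
  have h2 := b.dense_span
  rw [← Submodule.dense_iff_topologicalClosure_eq_top] at h2
  exact h2.mono h1

/-- Parseval's formula, with the multipliers moved across the inner product because they are real.
-/
theorem HilbertBasis.inner_eq_of_repr_left {ι : Type*} (b : HilbertBasis ι ℂ F) (m : ι → ℝ)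
    {f f' g g' : F} (hf : ∀ n, b.repr f' n = m n * b.repr f n)
    (hg : ∀ n, b.repr g' n = m n * b.repr g n) : inner ℂ f' g = inner ℂ f g' := by
  refine (b.hasSum_inner_mul_inner f' g).unique ?_
  convert b.hasSum_inner_mul_inner f g' using 2 with n
  have h1 := hf n
  have h2 := hg n
  rw [b.repr_apply_apply, b.repr_apply_apply] at h1 h2
  rw [h2, ← inner_conj_symm f' (b n), h1, ← inner_conj_symm f (b n), map_mul, Complex.conj_ofReal]
  ring

/-- Testing an adjoint pair `(f, g)` against the basis vectors gives the coefficients of `g` as `lam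
n` times those of `f`; maximality of the diagonal domain then puts the pair in the graph of `A`. -/
theorem IsDiagonalIn.isSelfAdjoint [CompleteSpace F] (h : IsDiagonalIn A lam b) :
    IsSelfAdjoint A := by
  have hd := h.dense_domain
  have hf : A.IsFormalAdjoint A := fun x y =>
    b.inner_eq_of_repr_left lam (h.repr_apply x) (h.repr_apply y)
  rw [LinearPMap.isSelfAdjoint_def]
  refine le_antisymm ?_ (hf.le_adjoint hd)
  refine LinearPMap.le_of_le_graph ?_
  rintro ⟨f, g⟩ hfg
  rw [LinearPMap.mem_graph_iff] at hfg
  obtain ⟨y, hy1, hy2⟩ := hfg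
  simp only at hy1 hy2
  refine (h f g).2 fun n => ?_
  have hn := h.basis_mem_graph n
  rw [LinearPMap.mem_graph_iff] at hn
  obtain ⟨x, hx1, hx2⟩ := hn
  have e : inner ℂ (A.adjoint y) (x : F) = inner ℂ (y : F) (A x) := by
    exact LinearPMap.adjoint_isFormalAdjoint hd y x
  simp only at hx1 hx2
  rw [hy1, hy2, hx1, hx2, inner_smul_right] at e
  rw [b.repr_apply_apply, b.repr_apply_apply, ← inner_conj_symm, e, map_mul, Complex.conj_ofReal,
    inner_conj_symm]

theorem IsDiagonalIn.inner_nonneg (h : IsDiagonalIn A lam b) (hlam : ∀ n, 0 ≤ lam n)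
    (f : A.domain) : ∃ r : ℝ, 0 ≤ r ∧ inner ℂ (f : F) (A f) = (r : ℂ) := by
  have h1 : HasSum (fun n => ((lam n * ‖b.repr f n‖ ^ 2 : ℝ) : ℂ)) (inner ℂ (f : F) (A f)) := by
    refine (b.hasSum_inner_mul_inner (f : F) (A f)).congr_fun fun n => ?_
    have := h.repr_apply f n
    rw [b.repr_apply_apply, b.repr_apply_apply] at this
    rw [this, b.repr_apply_apply, ← inner_conj_symm (f : F) (b n), mul_left_comm,
      ← Complex.normSq_eq_conj_mul_self, Complex.normSq_eq_norm_sq]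
    push_cast
    rfl
  have h2 : HasSum (fun n => lam n * ‖b.repr f n‖ ^ 2) (inner ℂ (f : F) (A f)).re := by
    simpa only [Complex.ofReal_re] using Complex.hasSum_re h1
  refine ⟨_, h2.nonneg fun n => mul_nonneg (hlam n) (by positivity), ?_⟩
  exact h1.unique (Complex.hasSum_ofReal.2 h2)

theorem IsDiagonalIn.mem_eigenspaceOf (h : IsDiagonalIn A lam b) (z : ℂ) (f : F) :
    f ∈ eigenspaceOf A z ↔ ∀ n, z * b.repr f n = lam n * b.repr f n := by
  have : f ∈ eigenspaceOf A z ↔ (f, z • f) ∈ A.graph := Iff.rfl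
  rw [this, h]
  simp

theorem IsDiagonalIn.eigenvalue_nonneg (h : IsDiagonalIn A lam b) (hlam : ∀ n, 0 ≤ lam n) (z : ℂ)
    (hz : eigenspaceOf A z ≠ ⊥) : ∃ r : ℝ, 0 ≤ r ∧ z = (r : ℂ) := by
  obtain ⟨f, hf, hf0⟩ := Submodule.exists_mem_ne_zero_of_ne_bot hz
  have : ∃ n, b.repr f n ≠ 0 := by
    by_contra! hn
    exact hf0 (b.ext_repr fun n => by simp [hn n])
  obtain ⟨n, hn⟩ := this
  exact ⟨lam n, hlam n, mul_right_cancel₀ hn ((h.mem_eigenspaceOf z f).1 hf n)⟩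

/-! ### The semigroup generated by a diagonal operator -/

/-- The operators `exp (-t A)`, `t ≥ 0`. -/
def HilbertBasis.expNeg (b : HilbertBasis ℕ ℂ F) (lam : ℕ → ℝ) (hlam : ∀ n, 0 ≤ lam n) (t : ℝ) :
    F →L[ℂ] F :=
  -- The absolute value makes the multipliers bounded by one for every real `t`; only `t ≥ 0`
  -- matters.
  b.diagonal (fun n => Real.exp (-(lam n * |t|))) fun n => by
    rw [Real.abs_exp, Real.exp_le_one_iff, neg_nonpos]
    exact mul_nonneg (hlam n) (abs_nonneg t)

theorem HilbertBasis.repr_expNeg (b : HilbertBasis ℕ ℂ F) (lam : ℕ → ℝ) (hlam : ∀ n, 0 ≤ lam n)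
    {t : ℝ} (ht : 0 ≤ t) (f : F) (n : ℕ) :
    b.repr (b.expNeg lam hlam t f) n = Real.exp (-(lam n * t)) * b.repr f n := by
  rw [expNeg, b.repr_diagonal, abs_of_nonneg ht]

theorem abs_exp_neg_sub_one_le {x : ℝ} (hx : 0 ≤ x) : |Real.exp (-x) - 1| ≤ x := by
  have := Real.add_one_le_exp (-x)
  rw [abs_of_nonpos (by simpa using hx)]
  linarith

/-- The coefficients of the difference quotient are at most `lam n * ‖b.repr f n‖` in norm, by `1 -
exp (-x) ≤ x`. This is the coefficient size of `g` itself, so `g` serves as the dominating vector.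
-/
theorem IsDiagonalIn.tendsto_generator (h : IsDiagonalIn A lam b) (hlam : ∀ n, 0 ≤ lam n)
    {f g : F} (hfg : (f, g) ∈ A.graph) :
    Tendsto (fun t : ℝ => t⁻¹ • (b.expNeg lam hlam t f - f)) (𝓝[>] 0) (𝓝 (-g)) := by
  have hg := (h f g).1 hfg
  have hrepr : ∀ t : ℝ, 0 < t → ∀ n, b.repr (t⁻¹ • (b.expNeg lam hlam t f - f)) n =
      ((t⁻¹ * (Real.exp (-(lam n * t)) - 1) : ℝ) : ℂ) * b.repr f n := fun t ht n => by
    have hs : t⁻¹ • (b.expNeg lam hlam t f - f) = ((t⁻¹ : ℝ) : ℂ) • (b.expNeg lam hlam t f - f) :=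
      (Complex.coe_smul _ _).symm
    rw [hs, map_smul, map_sub, lp.coeFn_smul, lp.coeFn_sub, Pi.smul_apply, Pi.sub_apply,
      b.repr_expNeg lam hlam ht.le, smul_eq_mul]
    push_cast
    ring
  refine b.tendsto_of_dominated _ (-g) g 2 (fun n => ?_) ?_
  · have hd : HasDerivAt (fun t => Real.exp (-(lam n * t))) (-lam n) 0 := by
      have := ((hasDerivAt_id (0 : ℝ)).const_mul (lam n)).neg.exp
      simpa using this
    have h1 := hd.tendsto_slope_zero_right
    simp only [zero_add, mul_zero, neg_zero, Real.exp_zero, smul_eq_mul] at h1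
    have h2 : Tendsto (fun t : ℝ => ((t⁻¹ * (Real.exp (-(lam n * t)) - 1) : ℝ) : ℂ) * b.repr f n)
        (𝓝[>] 0) (𝓝 (((-lam n : ℝ) : ℂ) * b.repr f n)) :=
      ((Complex.continuous_ofReal.tendsto _).comp h1).mul_const _
    have h3 : b.repr (-g) n = ((-lam n : ℝ) : ℂ) * b.repr f n := by
      rw [map_neg, lp.coeFn_neg, Pi.neg_apply, hg n]
      push_cast
      ring
    rw [h3]
    refine h2.congr' ?_
    filter_upwards [self_mem_nhdsWithin] with t ht
    exact (hrepr t ht n).symm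
  · filter_upwards [self_mem_nhdsWithin] with t ht n
    rw [sub_neg_eq_add, map_add, lp.coeFn_add, Pi.add_apply]
    refine (norm_add_le _ _).trans ?_
    rw [two_mul]
    gcongr
    rw [hrepr t ht n, hg n, norm_mul, norm_mul, Complex.norm_real, Complex.norm_real]
    gcongr
    have ht' : (0 : ℝ) < t := ht
    rw [Real.norm_eq_abs, Real.norm_eq_abs, abs_mul, abs_of_pos (inv_pos.2 ht'),
      abs_of_nonneg (hlam n), inv_mul_le_iff₀ ht', mul_comm t]
    exact abs_exp_neg_sub_one_le (mul_nonneg (hlam n) ht'.le)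

/-- The `n`-th coefficient of the quotient for `f` is that for `b n` times `b.repr f n`, so the
already known limit on basis vectors determines `g` coefficientwise. -/
theorem IsDiagonalIn.mem_graph_of_tendsto (h : IsDiagonalIn A lam b) (hlam : ∀ n, 0 ≤ lam n)
    {f g : F} (hfg : Tendsto (fun t : ℝ => t⁻¹ • (b.expNeg lam hlam t f - f)) (𝓝[>] 0) (𝓝 g)) :
    (f, -g) ∈ A.graph := by
  refine (h f (-g)).2 fun n => ?_
  have hcont : Continuous fun x : F => b.repr x n := by
    simp only [b.repr_apply_apply]
    fun_prop
  have h1 := (hcont.tendsto g).comp hfg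
  have h2 := (hcont.tendsto _).comp (h.tendsto_generator hlam (h.basis_mem_graph n))
  have key : ∀ t : ℝ, 0 < t → b.repr (t⁻¹ • (b.expNeg lam hlam t f - f)) n =
      b.repr (t⁻¹ • (b.expNeg lam hlam t (b n) - b n)) n * b.repr f n := fun t ht => by
    classical
    simp only [← Complex.coe_smul, map_smul, map_sub, lp.coeFn_smul, lp.coeFn_sub, Pi.smul_apply,
      Pi.sub_apply, b.repr_expNeg lam hlam ht.le, b.repr_self, lp.single_apply_self, smul_eq_mul]
    ring
  have h3 := h2.mul_const (b.repr f n)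
  have h4 := tendsto_nhds_unique h1 (h3.congr' (by
    filter_upwards [self_mem_nhdsWithin] with t ht using (key t ht).symm))
  classical
  rw [map_neg, lp.coeFn_neg, Pi.neg_apply, h4, map_neg, map_smul, b.repr_self, lp.coeFn_neg,
    lp.coeFn_smul, Pi.neg_apply, Pi.smul_apply, lp.single_apply_self]
  simp

theorem IsDiagonalIn.isSemigroup (h : IsDiagonalIn A lam b) (hlam : ∀ n, 0 ≤ lam n) :
    IsSemigroupWithGenerator (b.expNeg lam hlam) (-A) where
  map_zero := by
    ext f
    exact b.ext_repr fun n => by simp [b.repr_expNeg lam hlam le_rfl]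
  map_add := fun s t hs ht => by
    ext f
    refine b.ext_repr fun n => ?_
    rw [ContinuousLinearMap.comp_apply, b.repr_expNeg lam hlam (add_nonneg hs ht),
      b.repr_expNeg lam hlam hs, b.repr_expNeg lam hlam ht, ← mul_assoc, ← Complex.ofReal_mul,
      ← Real.exp_add]
    ring_nf
  strongly_continuous := fun f => by
    refine Continuous.continuousOn ?_
    refine continuous_iff_continuousAt.2 fun s => ?_
    refine b.tendsto_of_dominated _ _ f 2 (fun n => ?_) (Eventually.of_forall fun t n => ?_)
    · simp only [HilbertBasis.expNeg, HilbertBasis.repr_diagonal]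
      refine Continuous.tendsto ?_ s
      fun_prop
    · simp only [HilbertBasis.expNeg, map_sub, lp.coeFn_sub, Pi.sub_apply,
        HilbertBasis.repr_diagonal, ← sub_mul, norm_mul]
      gcongr
      rw [← Complex.ofReal_sub, Complex.norm_real]
      refine (norm_sub_le _ _).trans ?_
      have : ∀ r : ℝ, ‖Real.exp (-(lam n * |r|))‖ ≤ 1 := fun r => by
        rw [Real.norm_eq_abs, Real.abs_exp, Real.exp_le_one_iff, neg_nonpos]
        exact mul_nonneg (hlam n) (abs_nonneg r)
      linarith [this s, this t]
  generator := fun f g => by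
    have hneg : (f, g) ∈ (-A).graph ↔ (f, -g) ∈ A.graph := by
      rw [LinearPMap.mem_graph_iff, LinearPMap.mem_graph_iff]
      constructor
      · rintro ⟨y, h1, h2⟩
        exact ⟨⟨y, y.2⟩, h1, by simp only at h2 ⊢; rw [← h2]; simp⟩
      · rintro ⟨y, h1, h2⟩
        exact ⟨⟨y, y.2⟩, h1, by simp only at h2 ⊢; simp [h2]⟩
    rw [hneg]
    constructor
    · intro hfg
      simpa using h.tendsto_generator hlam hfg
    · exact h.mem_graph_of_tendsto hlam

theorem inv_one_add_div_pow_le_one {x : ℝ} (hx : 0 ≤ x) (n : ℕ) : |(1 + x / n)⁻¹| ≤ 1 := by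
  have : (0 : ℝ) ≤ x / n := by positivity
  rw [abs_of_nonneg (by positivity)]
  exact inv_le_one_of_one_le₀ (by linarith)

/-- A closed set that is invariant under the resolvents of `-A` is invariant under the
semigroup generated by `-A`. -/
theorem IsDiagonalIn.expNeg_mem (h : IsDiagonalIn A lam b) (hlam : ∀ n, 0 ≤ lam n) {P : Set F}
    (hP : IsClosed P)
    (hres : ∀ a : ℝ, 0 < a → ∀ f g, g ∈ P → (f, (a : ℂ) • (g - f)) ∈ A.graph → f ∈ P)
    {t : ℝ} (ht : 0 < t) {f : F} (hf : f ∈ P) : b.expNeg lam hlam t f ∈ P := by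
  have hnn : ∀ n, 0 ≤ lam n * t := fun n => mul_nonneg (hlam n) ht.le
  -- `R k` is `(1 + tA/k)⁻¹`: with `a = k / t`, the vector `f = R k g` satisfies `A f = a (g - f)`.
  -- For `k = 0` division by zero makes it the identity, which the limit does not see.
  let R : ℕ → F →L[ℂ] F := fun k =>
    b.diagonal (fun n => (1 + lam n * t / k)⁻¹) fun n => inv_one_add_div_pow_le_one (hnn n) k
  have hR : ∀ k : ℕ, 0 < k → ∀ g ∈ P, R k g ∈ P := fun k hk g hg => by
    have hk' : (0 : ℝ) < k := by exact_mod_cast hk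
    refine hres (k / t) (by positivity) _ g hg ((h _ _).2 fun n => ?_)
    have hpos : (0 : ℝ) < 1 + lam n * t / k := by
      have := hnn n
      positivity
    have hreal : k / t * (1 - (1 + lam n * t / k)⁻¹) = lam n * (1 + lam n * t / k)⁻¹ := by
      have h0 : (k : ℝ) + lam n * t ≠ 0 := by
        have := hnn n
        positivity
      have h1 : (k : ℝ) + t * lam n ≠ 0 := by rwa [mul_comm t]
      field_simp
      ring
    simp only [R, map_smul, map_sub, lp.coeFn_smul, lp.coeFn_sub, Pi.smul_apply, Pi.sub_apply,
      b.repr_diagonal, smul_eq_mul]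
    rw [← mul_assoc, ← Complex.ofReal_mul, ← hreal]
    push_cast
    ring
  have hpow : ∀ k : ℕ, 0 < k → ∀ j : ℕ, (R k ^ j) f ∈ P := fun k hk j => by
    induction j with
    | zero => simpa using hf
    | succ j ih =>
      rw [pow_succ']
      exact hR k hk _ ih
  have hrepr : ∀ k j n, b.repr ((R k ^ j) f) n = (((1 + lam n * t / k)⁻¹ ^ j : ℝ) : ℂ) * b.repr f n :=
    fun k j n => by
    induction j with
    | zero => simp
    | succ j ih =>
      rw [pow_succ', show (R k * R k ^ j) f = R k ((R k ^ j) f) from rfl, b.repr_diagonal, ih,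
        pow_succ']
      push_cast
      ring
  have hlim : Tendsto (fun k : ℕ => (R k ^ k) f) atTop (𝓝 (b.expNeg lam hlam t f)) := by
    refine b.tendsto_of_dominated _ _ f 2 (fun n => ?_) (Eventually.of_forall fun k n => ?_)
    · simp only [hrepr, b.repr_expNeg lam hlam ht.le]
      refine Tendsto.mul_const _ ((Complex.continuous_ofReal.tendsto _).comp ?_)
      have := (Real.tendsto_one_add_div_pow_exp (lam n * t)).inv₀ (Real.exp_pos _).ne'
      simpa [Real.exp_neg] using this
    · rw [map_sub, lp.coeFn_sub, Pi.sub_apply, hrepr, b.repr_expNeg lam hlam ht.le, ← sub_mul,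
        norm_mul]
      gcongr
      rw [← Complex.ofReal_sub, Complex.norm_real]
      refine (norm_sub_le _ _).trans ?_
      have h1 : ‖(1 + lam n * t / k)⁻¹ ^ k‖ ≤ 1 := by
        rw [norm_pow]
        exact pow_le_one₀ (norm_nonneg _) (inv_one_add_div_pow_le_one (hnn n) k)
      have h2 : ‖Real.exp (-(lam n * t))‖ ≤ 1 := by
        rw [Real.norm_eq_abs, Real.abs_exp, Real.exp_le_one_iff, neg_nonpos]
        exact hnn n
      linarith
  refine hP.mem_of_tendsto hlim ?_
  filter_upwards [eventually_gt_atTop 0] with k hk using hpow k hk k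

end Diagonal

/-! ## Enumeration of a discrete set and the spectral theorem -/

/-- Order `I` by `r`, breaking ties with an injection into `ℕ`. Initial segments are finite, so the
number of predecessors embeds `I` in `ℕ` strictly monotonically; the infinite range is then
enumerated in increasing order. -/
theorem exists_equiv_nat_monotone {I : Type*} [Infinite I] (r : I → ℝ)
    (hr : ∀ R, {i | r i ≤ R}.Finite) : ∃ e : ℕ ≃ I, Monotone (r ∘ e) := by
  classical
  have : Countable I := by
    rw [← Set.countable_univ_iff]
    refine (Set.countable_iUnion fun n : ℕ => (hr n).countable).mono fun i _ => ?_
    obtain ⟨n, hn⟩ := exists_nat_ge (r i)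
    exact mem_iUnion.2 ⟨n, hn⟩
  obtain ⟨c, hc⟩ := Countable.exists_injective_nat I
  let key : I → ℝ ×ₗ ℕ := fun i => toLex (r i, c i)
  have hkey : Function.Injective key := fun i j h => hc (congrArg (fun p => (ofLex p).2) h)
  let _ : LinearOrder I := LinearOrder.lift' key hkey
  have hle : ∀ i j : I, i ≤ j → r i ≤ r j := fun i j h => by
    have : key i ≤ key j := h
    rcases (Prod.Lex.le_iff (x := (r i, c i)) (y := (r j, c j))).1 this with h1 | h1
    · exact h1.le
    · exact h1.1.le
  have hfin : ∀ i : I, (Iio i).Finite := fun i =>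
    (hr (r i)).subset fun j hj => hle j i (le_of_lt hj)
  let rank : I → ℕ := fun i => (Iio i).ncard
  have hrank : StrictMono rank := fun i j hij =>
    Set.ncard_lt_ncard (Set.ssubset_iff_of_subset (Iio_subset_Iio hij.le) |>.2
      ⟨i, hij, lt_irrefl i⟩) (hfin j)
  have : Infinite (range rank) :=
    Set.infinite_coe_iff.2 (Set.infinite_range_of_injective hrank.injective)
  let e₁ := Nat.Subtype.orderIsoOfNat (range rank)
  let e₂ := Equiv.ofInjective rank hrank.injective
  refine ⟨e₁.toEquiv.trans e₂.symm, fun m n hmn => hle _ _ (hrank.le_iff_le.1 ?_)⟩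
  have h1 : ∀ k, rank (e₂.symm (e₁ k)) = e₁ k := fun k =>
    congrArg Subtype.val (e₂.apply_symm_apply (e₁ k))
  have h2 : (e₁ m : ℕ) ≤ e₁ n := e₁.monotone hmn
  simpa [h1] using h2

/-- An infinite orthonormal family of eigenvectors of a compact operator has only finitely many
members with eigenvalue bounded away from zero. -/
theorem IsCompactOperator.finite_eigenvalues_ge {M I : Type*} [NormedAddCommGroup M]
    [InnerProductSpace ℂ M] {S : M →L[ℂ] M} (hS : IsCompactOperator S) {v : I → M}
    (hv : Orthonormal ℂ v) {μ : I → ℝ} (hμ : ∀ i, S (v i) = (μ i : ℂ) • v i) {ε : ℝ} (hε : 0 < ε) :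
    {i | ε ≤ μ i}.Finite := by
  by_contra hinf
  have hinf : {i | ε ≤ μ i}.Infinite := hinf
  let c := hinf.natEmbedding
  obtain ⟨K, hK, hKS⟩ := hS.image_closedBall_subset_compact (𝕜₁ := ℂ) 1
  obtain ⟨a, -, ψ, hψ, ha⟩ := hK.tendsto_subseq (x := fun n => S (v (c n))) fun n =>
    hKS ⟨v (c n), by simp [hv.1], rfl⟩
  have hcau := ha.cauchySeq
  rw [Metric.cauchySeq_iff] at hcau
  obtain ⟨N, hN⟩ := hcau ε hε
  have hlt := hN N le_rfl (N + 1) (Nat.le_succ N)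
  set i := c (ψ N)
  set j := c (ψ (N + 1))
  have hij : (i : I) ≠ j := fun h => by
    have := hψ.injective (c.injective (Subtype.ext h))
    omega
  -- By Pythagoras the images of distinct orthonormal eigenvectors stay at distance at least `ε`, so
  -- no subsequence of them is Cauchy.
  have hge : ε ^ 2 ≤ ‖S (v i) - S (v j)‖ ^ 2 := by
    have horth : inner ℂ ((μ i : ℂ) • v i) (-((μ j : ℂ) • v j)) = 0 := by
      rw [inner_smul_left, inner_neg_right, inner_smul_right, hv.2 hij]
      simp
    rw [hμ, hμ, sub_eq_add_neg, sq ‖_‖,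
      norm_add_sq_eq_norm_sq_add_norm_sq_of_inner_eq_zero _ _ horth, norm_neg, norm_smul,
      norm_smul, hv.1, hv.1, mul_one, mul_one, Complex.norm_real, Complex.norm_real]
    have h1 : ε ≤ μ i := i.2
    have h2 : ε ≤ ‖μ i‖ := h1.trans (le_abs_self _)
    nlinarith [mul_self_nonneg ‖μ j‖, mul_self_le_mul_self hε.le h2]
  have := abs_le_of_sq_le_sq' hge (norm_nonneg _)
  rw [Function.comp_apply, Function.comp_apply, dist_eq_norm] at hlt
  linarith [this.2]

/-- The spectral theorem for a compact positive injective operator, in terms of the inverses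
`lam n` of its eigenvalues. -/
theorem IsCompactOperator.exists_hilbertBasis_nat {M : Type*} [NormedAddCommGroup M]
    [InnerProductSpace ℂ M] [CompleteSpace M] {S : M →L[ℂ] M} (hS : IsCompactOperator S)
    (hsymm : (S : M →ₗ[ℂ] M).IsSymmetric) (hpos : ∀ f, 0 ≤ (inner ℂ (S f) f).re)
    (hinj : ∀ f, S f = 0 → f = 0) (hinf : ¬ FiniteDimensional ℂ M) :
    ∃ (lam : ℕ → ℝ) (b : HilbertBasis ℕ ℂ M), (∀ n, 0 < lam n) ∧ Monotone lam ∧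
      Tendsto lam atTop atTop ∧ ∀ n, (lam n : ℂ) • S (b n) = b n := by
  classical
  let T : Module.End ℂ M := S
  have hex : ∀ z : ℂ, ∃ (w : Set (Module.End.eigenspace T z))
      (b : HilbertBasis w ℂ (Module.End.eigenspace T z)), ⇑b = ((↑) : w → _) := fun z => by
    have hclosed : IsClosed (Module.End.eigenspace T z : Set M) := by
      have : (Module.End.eigenspace T z : Set M) = {x | S x = z • x} := by
        ext x
        exact Module.End.mem_eigenspace_iff
      rw [this]
      exact isClosed_eq S.continuous (continuous_const_smul z)
    have : CompleteSpace (Module.End.eigenspace T z) := hclosed.completeSpace_coe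
    exact exists_hilbertBasis ℂ _
  choose w bz hbz using hex
  let I := Σ z : ℂ, w z
  let v : I → M := fun i => ((bz i.1 i.2 : Module.End.eigenspace T i.1) : M)
  have hv : Orthonormal ℂ v :=
    hsymm.orthogonalFamily_eigenspaces.orthonormal_sigma_orthonormal fun z => (bz z).orthonormal
  have heig : ∀ i, S (v i) = i.1 • v i := fun i =>
    Module.End.mem_eigenspace_iff.1 (bz i.1 i.2).2
  have hre : ∀ i : I, 0 < i.1.re ∧ (i.1.re : ℂ) = i.1 := fun i => by
    have h0 : v i ≠ 0 := fun h => by simpa [h] using hv.1 i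
    have hval : Module.End.HasEigenvalue T i.1 :=
      Module.End.hasEigenvalue_of_hasEigenvector ⟨(bz i.1 i.2).2, h0⟩
    have h1 : (i.1.re : ℂ) = i.1 := Complex.conj_eq_iff_re.1 (hsymm.conj_eigenvalue_eq_self hval)
    refine ⟨lt_of_le_of_ne ?_ fun h => ?_, h1⟩
    · have := hpos (v i)
      rw [heig, inner_smul_left, inner_self_eq_norm_sq_to_K, hv.1] at this
      simpa using this
    · refine h0 (hinj _ ?_)
      rw [heig, ← h1, ← h]
      simp
  -- Each eigenspace lies in the closed span of its own Hilbert basis, and the eigenspaces of a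
  -- compact symmetric operator have trivial joint orthogonal complement.
  have hspan : (Submodule.span ℂ (range v))ᗮ = ⊥ := by
    rw [eq_bot_iff, ← ContinuousLinearMap.orthogonalComplement_iSup_eigenspaces_eq_bot hS hsymm,
      ← Submodule.orthogonal_closure (Submodule.span ℂ (range v))]
    refine Submodule.orthogonal_le (iSup_le fun z x hx => ?_)
    have h1 := ((bz z).hasSum_repr ⟨x, hx⟩).mapL (Module.End.eigenspace T z).subtypeL
    refine (Submodule.isClosed_topologicalClosure _).mem_of_tendsto h1
      (Eventually.of_forall fun s => Submodule.sum_mem _ fun i _ => ?_)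
    refine Submodule.le_topologicalClosure _ ?_
    rw [map_smul]
    exact Submodule.smul_mem _ _ (Submodule.subset_span ⟨⟨z, i⟩, rfl⟩)
  let b₀ : HilbertBasis I ℂ M := HilbertBasis.mkOfOrthogonalEqBot hv hspan
  have hI : Infinite I := by
    by_contra h
    have : Finite I := not_infinite_iff_finite.1 h
    have := Fintype.ofFinite I
    exact hinf (Module.Basis.finiteDimensional_of_finite b₀.toOrthonormalBasis.toBasis)
  obtain ⟨e, he⟩ := exists_equiv_nat_monotone (fun i : I => i.1.re⁻¹) fun R => by
    -- Replacing `R` by `max R 1` keeps the threshold for the eigenvalues of `S` positive even when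
    -- `R ≤ 0`.
    refine (hS.finite_eigenvalues_ge hv (μ := fun i => i.1.re) (fun i => by
      rw [heig, (hre i).2]) (ε := (max R 1)⁻¹) (by positivity)).subset fun i hi => ?_
    have : i.1.re⁻¹ ≤ max R 1 := le_trans hi (le_max_left _ _)
    exact inv_le_of_inv_le₀ (hre i).1 this
  have hve : Orthonormal ℂ (v ∘ e) := hv.comp e e.injective
  refine ⟨fun n => (e n).1.re⁻¹, HilbertBasis.mkOfOrthogonalEqBot hve (by
    rwa [EquivLike.range_comp v e]), fun n => inv_pos.2 (hre _).1, he, ?_, fun n => ?_⟩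
  · refine (tendsto_atTop_atTop_of_monotone he) fun R => ?_
    by_contra! hlt
    refine Set.infinite_univ (α := ℕ) (((hS.finite_eigenvalues_ge hv (μ := fun i => i.1.re) (fun i => by
      rw [heig, (hre i).2]) (ε := (max R 1)⁻¹) (by positivity)).preimage
        e.injective.injOn).subset fun n _ => ?_)
    have : (e n).1.re⁻¹ ≤ max R 1 := le_trans (hlt n).le (le_max_left _ _)
    exact inv_le_of_inv_le₀ (hre _).1 this
  · rw [HilbertBasis.coe_mkOfOrthogonalEqBot, Function.comp_apply, heig, smul_smul]
    have h1 : (((e n).1.re⁻¹ : ℝ) : ℂ) * (e n).1 = 1 := by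
      conv_lhs => rw [← (hre (e n)).2]
      rw [← Complex.ofReal_mul, Complex.ofReal_re, inv_mul_cancel₀ (hre _).1.ne',
        Complex.ofReal_one]
    rw [h1, one_smul]

/-- A non-negative symmetric operator with one-dimensional kernel, whose range is the orthogonal
complement of the kernel and whose resolvent is compact, is diagonal in a Hilbert basis. -/
theorem exists_isDiagonalIn {F : Type*} [NormedAddCommGroup F] [InnerProductSpace ℂ F]
    [CompleteSpace F] (hinf : ¬ FiniteDimensional ℂ F) {A : F →ₗ.[ℂ] F} {e₀ : F}
    (he₀ : ‖e₀‖ = 1) (hker₀ : (e₀, 0) ∈ A.graph)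
    (hsymm : ∀ f h f' h', (f, h) ∈ A.graph → (f', h') ∈ A.graph → inner ℂ h f' = inner ℂ f h')
    (hpos : ∀ f h, (f, h) ∈ A.graph → 0 ≤ (inner ℂ f h).re)
    (hker : ∀ f, (f, 0) ∈ A.graph → f ∈ Submodule.span ℂ {e₀})
    (hsurj : ∀ h, inner ℂ e₀ h = 0 → ∃ f, (f, h) ∈ A.graph)
    (hcpt : ∀ C : ℝ, ∃ K, IsCompact K ∧ ∀ f h, (f, h) ∈ A.graph → ‖h‖ ≤ 1 → ‖f‖ ≤ C → f ∈ K) :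
    ∃ (lam : ℕ → ℝ) (b : HilbertBasis ℕ ℂ F), IsDiagonalIn A lam b ∧ lam 0 = 0 ∧
      (∀ n, 0 < lam (n + 1)) ∧ Monotone lam ∧ Tendsto lam atTop atTop ∧ b 0 = e₀ := by
  let L := Submodule.span ℂ {e₀}
  have hLmem : ∀ x, x ∈ Lᗮ ↔ inner ℂ e₀ x = 0 := fun x => Submodule.mem_orthogonal_singleton_iff_inner_right
  -- Removing the `e₀`-component of a solution stays within the solutions, since `e₀` is in the
  -- kernel; this singles out the inverse of `A` on `Lᗮ`.
  have hex : ∀ h : Lᗮ, ∃ f : Lᗮ, ((f : F), (h : F)) ∈ A.graph := fun h => by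
    obtain ⟨f, hf⟩ := hsurj h ((hLmem _).1 h.2)
    refine ⟨⟨f - inner ℂ e₀ f • e₀, (hLmem _).2 ?_⟩, ?_⟩
    · rw [inner_sub_right, inner_smul_right, inner_self_eq_norm_sq_to_K, he₀]
      simp
    · have := A.graph.sub_mem hf (A.graph.smul_mem (inner ℂ e₀ f) hker₀)
      simpa using this
  have huniq : ∀ f f' : Lᗮ, ∀ h : F, ((f : F), h) ∈ A.graph → ((f' : F), h) ∈ A.graph → f = f' :=
    fun f f' h hf hf' => by
    have h1 : ((f : F) - f', (0 : F)) ∈ A.graph := by simpa using A.graph.sub_mem hf hf'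
    have h2 := (Submodule.orthogonal_disjoint L).le_bot ⟨hker _ h1, Lᗮ.sub_mem f.2 f'.2⟩
    exact Subtype.ext (sub_eq_zero.1 h2)
  choose s hs using hex
  let S₀ : Lᗮ →ₗ[ℂ] Lᗮ :=
    { toFun := s
      map_add' := fun g h => huniq _ _ _ (hs _) (by simpa using A.graph.add_mem (hs g) (hs h))
      map_smul' := fun c h => huniq _ _ _ (hs _) (by simpa using A.graph.smul_mem c (hs h)) }
  have hS₀ : S₀.IsSymmetric := fun g h => (hsymm _ _ _ _ (hs g) (hs h)).symm
  -- Hellinger–Toeplitz: a symmetric operator defined on the whole Hilbert space is bounded.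
  let S : Lᗮ →L[ℂ] Lᗮ := ⟨S₀, hS₀.continuous⟩
  have hScpt : IsCompactOperator S := by
    obtain ⟨K, hK, hKmem⟩ := hcpt ‖S‖
    refine (isCompactOperator_iff_image_closedBall_subset_compact (𝕜₁ := ℂ) (S : Lᗮ →ₗ[ℂ] Lᗮ)
      one_pos).2 ⟨((↑) : Lᗮ → F) ⁻¹' K, ?_, ?_⟩
    · exact L.isClosed_orthogonal.isClosedEmbedding_subtypeVal.isCompact_preimage hK
    · rintro _ ⟨h, hh, rfl⟩
      have hh' : ‖h‖ ≤ 1 := by simpa using hh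
      refine hKmem _ _ (hs h) hh' ?_
      exact (S.le_opNorm h).trans (mul_le_of_le_one_right (norm_nonneg _) hh')
  have hMinf : ¬ FiniteDimensional ℂ Lᗮ := fun hfd => by
    refine hinf ?_
    have : FiniteDimensional ℂ (L ⊔ Lᗮ : Submodule ℂ F) := inferInstance
    rw [Submodule.sup_orthogonal_of_hasOrthogonalProjection] at this
    exact Module.Finite.of_surjective (Submodule.subtype ⊤) fun x => ⟨⟨x, trivial⟩, rfl⟩
  obtain ⟨lam, b, hlam, hmono, htend, heig⟩ := hScpt.exists_hilbertBasis_nat hS₀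
    (fun f => by
      have := hpos _ _ (hs f)
      exact this) (fun f hf => by
      have h1 : ((0 : F), (f : F)) ∈ A.graph := by simpa [hf] using (show ((S f : F), (f : F)) ∈ A.graph from hs f)
      exact Subtype.ext (A.graph_fst_eq_zero_snd h1 rfl)) hMinf
  let φ : ℕ → F := fun n => match n with
    | 0 => e₀
    | k + 1 => (b k : F)
  have hφ : Orthonormal ℂ φ := by
    refine ⟨fun n => ?_, fun m n hmn => ?_⟩
    · cases n with
      | zero => exact he₀
      | succ k => exact b.orthonormal.1 k
    · cases m with
      | zero =>
        cases n with
        | zero => exact absurd rfl hmn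
        | succ k => exact (hLmem _).1 (b k).2
      | succ j =>
        cases n with
        | zero => exact inner_eq_zero_symm.1 ((hLmem _).1 (b j).2)
        | succ k => exact b.orthonormal.2 (fun h => hmn (congrArg _ h))
  have hφ' : (Submodule.span ℂ (range φ))ᗮ = ⊥ := by
    rw [eq_bot_iff]
    intro x hx
    have hx' : ∀ n, inner ℂ (φ n) x = 0 := fun n => hx _ (Submodule.subset_span ⟨n, rfl⟩)
    have hxL : x ∈ Lᗮ := (hLmem _).2 (hx' 0)
    have : (⟨x, hxL⟩ : Lᗮ) = 0 := b.ext_repr fun n => by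
      rw [b.repr_apply_apply]
      simpa using hx' (n + 1)
    exact congrArg Subtype.val this
  let b' : HilbertBasis ℕ ℂ F := HilbertBasis.mkOfOrthogonalEqBot hφ hφ'
  have hb' : ∀ n, b' n = φ n := fun n => by rw [HilbertBasis.coe_mkOfOrthogonalEqBot]
  let lam' : ℕ → ℝ := fun n => match n with
    | 0 => 0
    | k + 1 => lam k
  have hgraph : ∀ n, (b' n, (lam' n : ℂ) • b' n) ∈ A.graph := fun n => by
    rw [hb']
    cases n with
    | zero => simpa [lam', φ] using hker₀
    | succ k =>
      have h1 := A.graph.smul_mem (lam k : ℂ) (hs (b k))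
      have h2 : (lam k : ℂ) • (s (b k) : F) = b k := congrArg Subtype.val (heig k)
      rw [Prod.smul_mk, h2] at h1
      exact h1
  have hdiag : ∀ f h, (f, h) ∈ A.graph → ∀ n, b'.repr h n = lam' n * b'.repr f n :=
    fun f h hfh n => by
    rw [b'.repr_apply_apply, b'.repr_apply_apply, ← hsymm _ _ _ _ (hgraph n) hfh, inner_smul_left,
      Complex.conj_ofReal]
  refine ⟨lam', b', fun f g => ⟨hdiag f g, fun hfg => ?_⟩, rfl, hlam, ?_, ?_, hb' 0⟩
  · have h0 : inner ℂ e₀ g = 0 := by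
      have := hfg 0
      rw [b'.repr_apply_apply, hb'] at this
      simpa [lam', φ] using this
    obtain ⟨f', hf'⟩ := hsurj g h0
    -- Maximality of the domain: `f` and the solution `f'` for the same `g` have equal coefficients
    -- wherever `lam'` is nonzero, hence differ only along `e₀`.
    have h1 : f = f' + (b'.repr (f - f') 0) • e₀ := by
      rw [← sub_eq_iff_eq_add']
      refine b'.ext_repr fun n => ?_
      rw [map_smul, show e₀ = b' 0 from (hb' 0).symm, b'.repr_self]
      cases n with
      | zero => simp
      | succ k =>
        have h2 := hdiag _ _ hf' (k + 1)
        rw [hfg (k + 1)] at h2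
        have h3 : (lam' (k + 1) : ℂ) ≠ 0 := by exact_mod_cast (hlam k).ne'
        have h4 := mul_left_cancel₀ h3 h2
        simp [h4]
    have h2 := A.graph.add_mem hf' (A.graph.smul_mem (b'.repr (f - f') 0) hker₀)
    rw [Prod.smul_mk, smul_zero, Prod.mk_add_mk, add_zero, ← h1] at h2
    exact h2
  · refine monotone_nat_of_le_succ fun n => ?_
    cases n with
    | zero => exact (hlam 0).le
    | succ k => exact hmono (Nat.le_succ k)
  · exact (tendsto_add_atTop_iff_nat 1).1 htend

namespace QuantumGraph

variable {V E : Type*} (G : QuantumGraph V E)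

/-! ## The space and the measure -/

theorem left_mem (e : E) : (0 : ℝ) ∈ Icc 0 (G.len e) := left_mem_Icc.2 (G.len_pos e).le

theorem right_mem (e : E) : G.len e ∈ Icc 0 (G.len e) := right_mem_Icc.2 (G.len_pos e).le

theorem pt_of_mem {e : E} {x : ℝ} (hx : x ∈ Icc 0 (G.len e)) :
    G.pt e x = Quot.mk _ (⟨e, ⟨x, hx⟩⟩ : G.Edges) := by
  rw [pt, projIcc_of_mem _ hx]

theorem exists_pt (x : G.Space) : ∃ e, ∃ s ∈ Icc 0 (G.len e), x = G.pt e s := by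
  obtain ⟨⟨e, s⟩, rfl⟩ := Quot.exists_rep x
  exact ⟨e, s, s.2, (G.pt_of_mem s.2).symm⟩

instance [Finite E] : CompactSpace G.Space :=
  inferInstanceAs (CompactSpace (Quot _))

instance [Nonempty E] : Nonempty G.Space :=
  ⟨G.pt (Classical.arbitrary E) 0⟩

/-- A vertex that meets no edge has no point in `X`; it receives an arbitrary value, which no edge
ever reads. -/
theorem exists_vertex [Nonempty E] :
    ∃ τ : V → G.Space, ∀ e, G.pt e 0 = τ (G.src e) ∧ G.pt e (G.len e) = τ (G.tgt e) := by
  classical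
  let τ : V → G.Space := fun v =>
    if h : ∃ p : G.Edges, G.IsEndAt p v then Quot.mk _ h.choose else Classical.arbitrary _
  have hτ : ∀ (p : G.Edges) v, G.IsEndAt p v → Quot.mk _ p = τ v := fun p v hp => by
    have h : ∃ p : G.Edges, G.IsEndAt p v := ⟨p, hp⟩
    have h2 : τ v = Quot.mk _ h.choose := dif_pos h
    rw [h2]
    exact Quot.sound ⟨v, hp, h.choose_spec⟩
  refine ⟨τ, fun e => ⟨?_, ?_⟩⟩
  · rw [G.pt_of_mem (G.left_mem e)]
    exact hτ _ _ (Or.inl ⟨rfl, rfl⟩)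
  · rw [G.pt_of_mem (G.right_mem e)]
    exact hτ _ _ (Or.inr ⟨rfl, rfl⟩)

/-- Continuous functions on the edges with compatible values at the vertices glue. -/
theorem exists_glue {Y : Type*} [TopologicalSpace Y] (w : E → ℝ → Y) (c : V → Y)
    (hw : ∀ e, ContinuousOn (w e) (Icc 0 (G.len e))) (h0 : ∀ e, w e 0 = c (G.src e))
    (h1 : ∀ e, w e (G.len e) = c (G.tgt e)) :
    ∃ u : C(G.Space, Y), ∀ e, ∀ s ∈ Icc 0 (G.len e), u (G.pt e s) = w e s := by
  have hend : ∀ (p : G.Edges) v, G.IsEndAt p v → w p.1 p.2 = c v := by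
    rintro ⟨e, s⟩ v (⟨hs, hv⟩ | ⟨hs, hv⟩)
    · simp only at hs hv ⊢
      rw [hs, h0, hv]
    · simp only at hs hv ⊢
      rw [hs, h1, hv]
  let f : G.Space → Y := Quot.lift (fun p : G.Edges => w p.1 p.2) (by
    rintro p q ⟨v, hp, hq⟩
    rw [hend p v hp, hend q v hq])
  have hf : Continuous f := by
    refine continuous_quot_lift _ (continuous_sigma fun e => ?_)
    exact (hw e).comp_continuous continuous_subtype_val fun s => s.2
  refine ⟨⟨f, hf⟩, fun e s hs => ?_⟩
  rw [G.pt_of_mem hs]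
  rfl

instance isFiniteMeasure_vol [Finite E] : IsFiniteMeasure G.vol := by
  have := Fintype.ofFinite E
  rw [vol, Measure.sum_fintype]
  infer_instance

/-- Used to make continuous versions unique and to upgrade almost-everywhere information about
continuous functions to every point. An open set meeting an edge, even only at an end, meets its
interior. -/
instance isOpenPosMeasure_vol : G.vol.IsOpenPosMeasure := by
  refine ⟨fun U hU hne h0 => ?_⟩
  obtain ⟨x, hx⟩ := hne
  obtain ⟨e, s, hs, rfl⟩ := G.exists_pt x
  have h1 : ((volume.restrict (Icc 0 (G.len e))).map (G.pt e)) U = 0 :=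
    le_antisymm ((G.map_pt_le_vol e U).trans h0.le) zero_le
  have hU' := hU.preimage (G.continuous_pt e)
  rw [Measure.map_apply (G.continuous_pt e).measurable hU.measurableSet,
    Measure.restrict_apply hU'.measurableSet] at h1
  have hcl : s ∈ closure (Ioo 0 (G.len e)) := by rwa [closure_Ioo (G.len_pos e).ne]
  have hne : ((G.pt e ⁻¹' U) ∩ Ioo 0 (G.len e)).Nonempty :=
    mem_closure_iff.1 hcl _ hU' hx
  exact ((hU'.inter isOpen_Ioo).measure_pos volume hne).ne'
    (measure_mono_null (inter_subset_inter_right _ Ioo_subset_Icc_self) h1)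

theorem integral_vol [Fintype E] {f : G.Space → ℂ} (hf : Integrable f G.vol) :
    ∫ x, f x ∂G.vol = ∑ e, ∫ s in (0 : ℝ)..G.len e, f (G.pt e s) := by
  have hfe : ∀ e, Integrable f ((volume.restrict (Icc 0 (G.len e))).map (G.pt e)) := fun e =>
    hf.mono_measure (G.map_pt_le_vol e)
  have : G.vol = ∑ e, (volume.restrict (Icc 0 (G.len e))).map (G.pt e) := by
    rw [vol, Measure.sum_fintype]
  rw [this, integral_finsetSum_measure fun e _ => hfe e]
  refine Finset.sum_congr rfl fun e _ => ?_
  rw [integral_map (G.continuous_pt e).aemeasurable (hfe e).aestronglyMeasurable,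
    intervalIntegral.integral_of_le (G.len_pos e).le, integral_Icc_eq_integral_Ioc]

/-- Two continuous functions that agree almost everywhere agree. -/
theorem eq_of_ae_eq {u v : C(G.Space, ℂ)} (h : u =ᵐ[G.vol] v) : u = v :=
  DFunLike.coe_injective (Continuous.ae_eq_iff_eq G.vol u.continuous v.continuous |>.1 h)

variable [Fintype E]

theorem inner_eq_sum (f g : G.L2) {f' g' : G.Space → ℂ} (hf : f =ᵐ[G.vol] f')
    (hg : g =ᵐ[G.vol] g') :
    inner ℂ f g = ∑ e, ∫ s in (0 : ℝ)..G.len e,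
      starRingEnd ℂ (f' (G.pt e s)) * g' (G.pt e s) := by
  have h1 : (fun x => inner ℂ (f x) (g x)) =ᵐ[G.vol] fun x => starRingEnd ℂ (f' x) * g' x := by
    filter_upwards [hf, hg] with x hx hx'
    rw [hx, hx', RCLike.inner_apply, mul_comm]
  rw [L2.inner_def, integral_congr_ae h1]
  exact G.integral_vol ((L2.integrable_inner f g).congr h1)

theorem norm_sq_eq_sum (f : G.L2) {u : G.Space → ℂ} (hf : f =ᵐ[G.vol] u) :
    ‖f‖ ^ 2 = ∑ e, ∫ s in (0 : ℝ)..G.len e, ‖u (G.pt e s)‖ ^ 2 := by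
  have h1 := G.inner_eq_sum f f hf hf
  have h2 : ∀ z : ℂ, starRingEnd ℂ z * z = ((‖z‖ ^ 2 : ℝ) : ℂ) := fun z => by
    rw [← Complex.normSq_eq_conj_mul_self, Complex.normSq_eq_norm_sq]
  simp only [h2, intervalIntegral.integral_ofReal] at h1
  rw [inner_self_eq_norm_sq_to_K] at h1
  rw [← Complex.ofReal_sum] at h1
  exact Complex.ofReal_injective (by rw [← h1]; push_cast; rfl)

/-- Polynomials times `s (ℓ - s)` on one edge vanish at its ends, so extension by zero embeds the
polynomial ring in the continuous functions and then in `L²`. -/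
theorem not_finiteDimensional_L2 [Nonempty E] : ¬ FiniteDimensional ℂ G.L2 := by
  intro hfd
  classical
  let e : E := Classical.arbitrary E
  have hex : ∀ p : Polynomial ℂ, ∃ u : C(G.Space, ℂ), ∀ e', ∀ s ∈ Icc 0 (G.len e'),
      u (G.pt e' s) = if e' = e then (s : ℂ) * (G.len e - s) * p.eval (s : ℂ) else 0 := fun p => by
    refine G.exists_glue (fun e' s => if e' = e then (s : ℂ) * (G.len e - s) * p.eval (s : ℂ) else 0)
      (fun _ => 0) (fun e' => ?_) (fun e' => ?_) (fun e' => ?_)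
    · by_cases h : e' = e
      · simp only [h, if_true]
        fun_prop
      · simp only [h, if_false]
        fun_prop
    · simp
    · by_cases h : e' = e <;> simp [h]
  choose u hu using hex
  have huniq : ∀ u v : C(G.Space, ℂ), (∀ e', ∀ s ∈ Icc 0 (G.len e'),
      u (G.pt e' s) = v (G.pt e' s)) → u = v := fun u v h => by
    ext x
    obtain ⟨e', s, hs, rfl⟩ := G.exists_pt x
    exact h e' s hs
  let T : Polynomial ℂ →ₗ[ℂ] C(G.Space, ℂ) :=
    { toFun := u
      map_add' := fun p q => huniq _ _ fun e' s hs => by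
        rw [ContinuousMap.add_apply, hu _ _ _ hs, hu _ _ _ hs, hu _ _ _ hs]
        split_ifs <;> simp; ring
      map_smul' := fun c p => huniq _ _ fun e' s hs => by
        rw [ContinuousMap.smul_apply, hu _ _ _ hs, hu _ _ _ hs]
        split_ifs <;> simp; ring }
  have hT : Function.Injective T := by
    refine (injective_iff_map_eq_zero T).2 fun p hp => ?_
    refine Polynomial.eq_zero_of_infinite_isRoot p ?_
    have hinf : (Complex.ofReal '' Ioo 0 (G.len e)).Infinite :=
      (Ioo_infinite (G.len_pos e)).image Complex.ofReal_injective.injOn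
    refine hinf.mono ?_
    rintro _ ⟨s, hs, rfl⟩
    have h1 := hu p e s (Ioo_subset_Icc_self hs)
    have h2 : u p = 0 := hp
    rw [h2, if_pos rfl, ContinuousMap.zero_apply, eq_comm, mul_eq_zero, mul_eq_zero] at h1
    rcases h1 with (h1 | h1) | h1
    · exact absurd (by exact_mod_cast h1) hs.1.ne'
    · rw [sub_eq_zero] at h1
      exact absurd (by exact_mod_cast h1) hs.2.ne'
    · exact h1
  have hI : Function.Injective (ContinuousMap.toLp 2 G.vol ℂ : C(G.Space, ℂ) →L[ℂ] G.L2) :=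
    ContinuousMap.toLp_injective G.vol
  have := Module.Finite.of_injective
    ((ContinuousMap.toLp 2 G.vol ℂ : C(G.Space, ℂ) →L[ℂ] G.L2).toLinearMap ∘ₗ T) (hI.comp hT)
  exact Polynomial.not_finite this

end QuantumGraph

/-! ## Calculus on an interval -/

section Interval

variable {l : ℝ} {v dv : ℝ → ℂ}

theorem integral_eq_sub_of_hasDerivWithinAt_Icc
    (hv : ∀ x ∈ Icc 0 l, HasDerivWithinAt v (dv x) (Icc 0 l) x) (hdv : ContinuousOn dv (Icc 0 l))
    {x y : ℝ} (hx : x ∈ Icc 0 l) (hy : y ∈ Icc 0 l) (hxy : x ≤ y) :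
    ∫ s in x..y, dv s = v y - v x := by
  have hsub : Icc x y ⊆ Icc 0 l := Icc_subset_Icc hx.1 hy.2
  refine intervalIntegral.integral_eq_sub_of_hasDerivAt_of_le hxy
    (fun s hs => (hv s (hsub hs)).continuousWithinAt.mono hsub) (fun s hs => ?_) ?_
  · exact (hv s (hsub (Ioo_subset_Icc_self hs))).hasDerivAt
      (Icc_mem_nhds (hx.1.trans_lt hs.1) (hs.2.trans_le hy.2))
  · exact (hdv.mono hsub).intervalIntegrable_of_Icc hxy

/-- Fubini on the triangle `s ≤ x`. This gives integration by parts for a `g` that is merely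
integrable. -/
theorem integral_primitive_mul {g w : ℝ → ℂ} (hl : 0 ≤ l) (hg : IntegrableOn g (Icc 0 l))
    (hw : ContinuousOn w (Icc 0 l)) :
    ∫ x in (0 : ℝ)..l, (∫ s in (0 : ℝ)..x, g s) * w x =
      ∫ s in (0 : ℝ)..l, g s * ∫ x in s..l, w x := by
  have hg' : Integrable g (volume.restrict (Ioc 0 l)) := hg.mono_set Ioc_subset_Icc_self
  have hw' : Integrable w (volume.restrict (Ioc 0 l)) :=
    (hw.integrableOn_Icc).mono_set Ioc_subset_Icc_self
  let D : Set (ℝ × ℝ) := {p | p.2 ≤ p.1}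
  have hD : MeasurableSet D := measurableSet_le measurable_snd measurable_fst
  have hint : Integrable (Function.uncurry fun x s => D.indicator (fun p => w p.1 * g p.2) (x, s))
      ((volume.restrict (Ioc 0 l)).prod (volume.restrict (Ioc 0 l))) :=
    (hw'.mul_prod hg').indicator hD
  have hswap := integral_integral_swap hint
  rw [intervalIntegral.integral_of_le hl, intervalIntegral.integral_of_le hl]
  refine Eq.trans ?_ (hswap.trans ?_)
  · refine setIntegral_congr_fun measurableSet_Ioc fun x hx => ?_
    have h1 : (fun s => D.indicator (fun p => w p.1 * g p.2) (x, s)) =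
        (Iic x).indicator fun s => w x * g s := rfl
    simp only [h1]
    rw [integral_indicator measurableSet_Iic, Measure.restrict_restrict measurableSet_Iic,
      Iic_inter_Ioc_of_le hx.2, integral_const_mul, intervalIntegral.integral_of_le hx.1.le, mul_comm]
  · refine setIntegral_congr_fun measurableSet_Ioc fun s hs => ?_
    have h1 : (fun x => D.indicator (fun p => w p.1 * g p.2) (x, s)) =
        (Ici s).indicator fun x => w x * g s := rfl
    simp only [h1]
    rw [integral_indicator measurableSet_Ici, Measure.restrict_restrict measurableSet_Ici]
    have h2 : (Ici s ∩ Ioc 0 l) = Icc s l := by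
      ext x
      simp only [mem_inter_iff, mem_Ici, mem_Ioc, mem_Icc]
      exact ⟨fun h => ⟨h.1, h.2.2⟩, fun h => ⟨h.1, hs.1.trans_le h.1, h.2⟩⟩
    rw [h2, integral_Icc_eq_integral_Ioc, integral_mul_const,
      intervalIntegral.integral_of_le hs.2, mul_comm]

/-- Integration by parts when one factor is the primitive of an integrable function. -/
theorem integral_mul_eq_of_primitive {g p : ℝ → ℂ} (hl : 0 ≤ l) (hg : IntegrableOn g (Icc 0 l))
    (hp : ∀ x ∈ Icc 0 l, p x = p 0 - ∫ s in (0 : ℝ)..x, g s)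
    (hv : ∀ x ∈ Icc 0 l, HasDerivWithinAt v (dv x) (Icc 0 l) x)
    (hdv : ContinuousOn dv (Icc 0 l)) :
    ∫ s in (0 : ℝ)..l, g s * v s = p 0 * v 0 - p l * v l + ∫ s in (0 : ℝ)..l, p s * dv s := by
  have h0 : (0 : ℝ) ∈ Icc 0 l := left_mem_Icc.2 hl
  have h1 : l ∈ Icc 0 l := right_mem_Icc.2 hl
  have hgi : IntervalIntegrable g volume 0 l :=
    (intervalIntegrable_iff_integrableOn_Icc_of_le hl).2 hg
  have hvc : ContinuousOn v (uIcc 0 l) := by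
    rw [uIcc_of_le hl]
    exact fun x hx => (hv x hx).continuousWithinAt
  have hdvi : IntervalIntegrable dv volume 0 l := hdv.intervalIntegrable_of_Icc hl
  have hP : ContinuousOn (fun x => ∫ s in (0 : ℝ)..x, g s) (uIcc 0 l) :=
    intervalIntegral.continuousOn_primitive_interval' hgi left_mem_uIcc
  have e1 : ∫ s in (0 : ℝ)..l, p s * dv s =
      p 0 * (v l - v 0) - ∫ x in (0 : ℝ)..l, (∫ s in (0 : ℝ)..x, g s) * dv x := by
    rw [← integral_eq_sub_of_hasDerivWithinAt_Icc hv hdv h0 h1 hl,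
      ← intervalIntegral.integral_const_mul, ← intervalIntegral.integral_sub
        (hdvi.const_mul _) (hdvi.continuousOn_mul hP)]
    refine intervalIntegral.integral_congr fun x hx => ?_
    rw [uIcc_of_le hl] at hx
    rw [hp x hx, sub_mul]
  have e2 : ∫ s in (0 : ℝ)..l, g s * ∫ x in s..l, dv x =
      (∫ s in (0 : ℝ)..l, g s) * v l - ∫ s in (0 : ℝ)..l, g s * v s := by
    rw [← intervalIntegral.integral_mul_const, ← intervalIntegral.integral_sub
        (hgi.mul_const _) (hgi.mul_continuousOn hvc)]
    refine intervalIntegral.integral_congr fun x hx => ?_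
    rw [uIcc_of_le hl] at hx
    rw [integral_eq_sub_of_hasDerivWithinAt_Icc hv hdv hx h1 hx.2, mul_sub]
  rw [e1, integral_primitive_mul hl hg hdv, e2, hp l h1]
  ring

theorem ContinuousOn.intervalIntegrable_norm_sq {w : ℝ → ℂ} {l : ℝ} (hl : 0 ≤ l)
    (hw : ContinuousOn w (Icc 0 l)) : IntervalIntegrable (fun s => ‖w s‖ ^ 2) volume 0 l :=
  (hw.norm.pow 2).intervalIntegrable_of_Icc hl

/-- Integrate `‖v'‖ ≤ ε ‖v'‖² + ε⁻¹`. Keeping `ε` free replaces the Hölder-1/2 estimate by one that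
is linear in the energy. -/
theorem norm_sub_le_of_energy (hv : ∀ x ∈ Icc 0 l, HasDerivWithinAt v (dv x) (Icc 0 l) x)
    (hdv : ContinuousOn dv (Icc 0 l)) {x y : ℝ} (hx : x ∈ Icc 0 l) (hy : y ∈ Icc 0 l)
    {ε : ℝ} (hε : 0 < ε) :
    ‖v y - v x‖ ≤ ε * (∫ s in (0 : ℝ)..l, ‖dv s‖ ^ 2) + ε⁻¹ * |y - x| := by
  wlog hxy : x ≤ y generalizing x y
  · rw [norm_sub_rev, abs_sub_comm]
    exact this hy hx (le_of_not_ge hxy)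
  have hsub : Icc x y ⊆ Icc 0 l := Icc_subset_Icc hx.1 hy.2
  have hl : 0 ≤ l := hx.1.trans hx.2
  have hn : ContinuousOn (fun s => ‖dv s‖ ^ 2) (Icc 0 l) := hdv.norm.pow 2
  have hi : IntervalIntegrable (fun s => ‖dv s‖ ^ 2) volume x y :=
    (hn.mono hsub).intervalIntegrable_of_Icc hxy
  rw [← integral_eq_sub_of_hasDerivWithinAt_Icc hv hdv hx hy hxy]
  calc ‖∫ s in x..y, dv s‖ ≤ ∫ s in x..y, ‖dv s‖ :=
        intervalIntegral.norm_integral_le_integral_norm hxy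
    _ ≤ ∫ s in x..y, (ε * ‖dv s‖ ^ 2 + ε⁻¹) := by
        refine intervalIntegral.integral_mono_on hxy
          ((hdv.norm.mono hsub).intervalIntegrable_of_Icc hxy)
          ((hi.const_mul ε).add intervalIntegrable_const) fun s _ => ?_
        have h1 : ε * ‖dv s‖ ^ 2 + ε⁻¹ - ‖dv s‖ =
            ε * (‖dv s‖ - ε⁻¹ / 2) ^ 2 + 3 / 4 * ε⁻¹ := by
          field_simp
          ring
        have h2 : 0 ≤ ε * (‖dv s‖ - ε⁻¹ / 2) ^ 2 + 3 / 4 * ε⁻¹ := by positivity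
        linarith
    _ = ε * (∫ s in x..y, ‖dv s‖ ^ 2) + ε⁻¹ * |y - x| := by
        rw [intervalIntegral.integral_add (hi.const_mul ε) intervalIntegrable_const,
          intervalIntegral.integral_const_mul, intervalIntegral.integral_const, smul_eq_mul,
          abs_of_nonneg (sub_nonneg.2 hxy), mul_comm ε⁻¹]
    _ ≤ _ := by
        gcongr
        exact intervalIntegral.integral_mono_interval hx.1 hxy hy.2
          (Eventually.of_forall fun s => by positivity) (hn.intervalIntegrable_of_Icc hl)

/-- The derivative of `‖v‖²` is at most `2 ‖v‖ ‖v'‖ ≤ ε ‖v‖² + ε⁻¹ ‖v'‖²` in absolute value. -/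
theorem norm_sq_le_of_energy (hv : ∀ x ∈ Icc 0 l, HasDerivWithinAt v (dv x) (Icc 0 l) x)
    (hdv : ContinuousOn dv (Icc 0 l)) {x y : ℝ} (hx : x ∈ Icc 0 l) (hy : y ∈ Icc 0 l)
    {ε : ℝ} (hε : 0 < ε) :
    ‖v y‖ ^ 2 ≤ ‖v x‖ ^ 2 + (ε * (∫ s in (0 : ℝ)..l, ‖v s‖ ^ 2) +
      ε⁻¹ * ∫ s in (0 : ℝ)..l, ‖dv s‖ ^ 2) := by
  have hl : 0 ≤ l := hx.1.trans hx.2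
  have hvc : ContinuousOn v (Icc 0 l) := fun s hs => (hv s hs).continuousWithinAt
  have hn : ContinuousOn (fun s => ε * ‖v s‖ ^ 2 + ε⁻¹ * ‖dv s‖ ^ 2) (Icc 0 l) :=
    (continuousOn_const.mul (hvc.norm.pow 2)).add (continuousOn_const.mul (hdv.norm.pow 2))
  have hq : ∀ s ∈ Icc 0 l, HasDerivWithinAt (fun s => starRingEnd ℂ (v s) * v s)
      (starRingEnd ℂ (dv s) * v s + starRingEnd ℂ (v s) * dv s) (Icc 0 l) s := fun s hs =>
    (hv s hs).star.mul (hv s hs)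
  have hdq : ContinuousOn (fun s => starRingEnd ℂ (dv s) * v s + starRingEnd ℂ (v s) * dv s)
      (Icc 0 l) :=
    ((Complex.continuous_conj.comp_continuousOn hdv).mul hvc).add
      ((Complex.continuous_conj.comp_continuousOn hvc).mul hdv)
  have hbound : ∀ a ∈ Icc 0 l, ∀ c ∈ Icc 0 l, a ≤ c → |‖v c‖ ^ 2 - ‖v a‖ ^ 2| ≤
      ε * (∫ s in (0 : ℝ)..l, ‖v s‖ ^ 2) + ε⁻¹ * ∫ s in (0 : ℝ)..l, ‖dv s‖ ^ 2 :=
    fun a ha c hc hac => by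
    have hsub : Icc a c ⊆ Icc 0 l := Icc_subset_Icc ha.1 hc.2
    have h1 := integral_eq_sub_of_hasDerivWithinAt_Icc hq hdq ha hc hac
    have h2 : ∀ z : ℂ, starRingEnd ℂ z * z = ((‖z‖ ^ 2 : ℝ) : ℂ) := fun z => by
      rw [← Complex.normSq_eq_conj_mul_self, Complex.normSq_eq_norm_sq]
    rw [h2, h2, ← Complex.ofReal_sub] at h1
    rw [← Real.norm_eq_abs, ← Complex.norm_real, ← h1]
    calc _ ≤ ∫ s in a..c, ‖starRingEnd ℂ (dv s) * v s + starRingEnd ℂ (v s) * dv s‖ :=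
          intervalIntegral.norm_integral_le_integral_norm hac
      _ ≤ ∫ s in a..c, (ε * ‖v s‖ ^ 2 + ε⁻¹ * ‖dv s‖ ^ 2) := by
          refine intervalIntegral.integral_mono_on hac
            ((hdq.norm.mono hsub).intervalIntegrable_of_Icc hac)
            ((hn.mono hsub).intervalIntegrable_of_Icc hac) fun s _ => ?_
          refine (norm_add_le _ _).trans ?_
          rw [norm_mul, norm_mul, RCLike.norm_conj, RCLike.norm_conj]
          have h3 : ε * ‖v s‖ ^ 2 + ε⁻¹ * ‖dv s‖ ^ 2 - (‖dv s‖ * ‖v s‖ + ‖v s‖ * ‖dv s‖) =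
              ε * (‖v s‖ - ε⁻¹ * ‖dv s‖) ^ 2 := by
            field_simp
            ring
          have h4 : 0 ≤ ε * (‖v s‖ - ε⁻¹ * ‖dv s‖) ^ 2 := by positivity
          linarith
      _ ≤ ∫ s in (0 : ℝ)..l, (ε * ‖v s‖ ^ 2 + ε⁻¹ * ‖dv s‖ ^ 2) :=
          intervalIntegral.integral_mono_interval ha.1 hac hc.2
            (Eventually.of_forall fun s => by positivity) (hn.intervalIntegrable_of_Icc hl)
      _ = _ := by
          rw [intervalIntegral.integral_add
            ((hvc.intervalIntegrable_norm_sq hl).const_mul ε)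
            ((hdv.intervalIntegrable_norm_sq hl).const_mul ε⁻¹),
            intervalIntegral.integral_const_mul, intervalIntegral.integral_const_mul]
  rcases le_total x y with h | h
  · linarith [(abs_le.1 (hbound x hx y hy h)).2]
  · linarith [(abs_le.1 (hbound y hy x hx h)).1]

/-- A one-dimensional Sobolev inequality. -/
theorem norm_sq_le_sobolev (hl : 0 < l) (hv : ∀ x ∈ Icc 0 l, HasDerivWithinAt v (dv x) (Icc 0 l) x)
    (hdv : ContinuousOn dv (Icc 0 l)) {y : ℝ} (hy : y ∈ Icc 0 l) {ε : ℝ} (hε : 0 < ε) :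
    ‖v y‖ ^ 2 ≤ (l⁻¹ + ε) * (∫ s in (0 : ℝ)..l, ‖v s‖ ^ 2) +
      ε⁻¹ * ∫ s in (0 : ℝ)..l, ‖dv s‖ ^ 2 := by
  have hvc : ContinuousOn v (Icc 0 l) := fun s hs => (hv s hs).continuousWithinAt
  -- Average the two-point inequality over the free point `x` in the interval.
  have h1 : ∫ _ in (0 : ℝ)..l, ‖v y‖ ^ 2 ≤ ∫ x in (0 : ℝ)..l, (‖v x‖ ^ 2 +
      (ε * (∫ s in (0 : ℝ)..l, ‖v s‖ ^ 2) + ε⁻¹ * ∫ s in (0 : ℝ)..l, ‖dv s‖ ^ 2)) :=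
    intervalIntegral.integral_mono_on hl.le intervalIntegrable_const
      ((hvc.intervalIntegrable_norm_sq hl.le).add intervalIntegrable_const)
      fun x hx => norm_sq_le_of_energy hv hdv hx hy hε
  rw [intervalIntegral.integral_add (hvc.intervalIntegrable_norm_sq hl.le)
    intervalIntegrable_const, intervalIntegral.integral_const, intervalIntegral.integral_const,
    smul_eq_mul, smul_eq_mul, sub_zero] at h1
  have h2 := mul_le_mul_of_nonneg_left h1 (inv_nonneg.2 hl.le)
  rw [mul_add, inv_mul_cancel_left₀ hl.ne', inv_mul_cancel_left₀ hl.ne'] at h2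
  linarith

end Interval

theorem intervalIntegral_conj (a b : ℝ) (g : ℝ → ℂ) :
    ∫ s in a..b, starRingEnd ℂ (g s) = starRingEnd ℂ (∫ s in a..b, g s) := by
  rw [intervalIntegral, intervalIntegral, map_sub, integral_conj, integral_conj]

namespace QuantumGraph

variable {V E : Type*} {G : QuantumGraph V E}

theorem energy_nonneg (du : E → ℝ → ℂ) (e : E) :
    0 ≤ ∫ s in (0 : ℝ)..G.len e, ‖du e s‖ ^ 2 :=
  intervalIntegral.integral_nonneg (G.len_pos e).le fun _ _ => by positivity

variable (G) [Fintype E]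

/-! ## Green's identity and energy estimates -/

/-- `u` is the continuous version, with edge derivatives `du`, of an element of the domain of `H₀`
that `H₀` maps to `h`. -/
structure IsKirchhoffRep (u : C(G.Space, ℂ)) (du : E → ℝ → ℂ) (h : G.L2) : Prop where
  hasDeriv : ∀ e, ∀ x ∈ Icc 0 (G.len e),
    HasDerivWithinAt (fun s => u (G.pt e s)) (du e x) (Icc 0 (G.len e)) x
  primitive : ∀ e, ∀ x ∈ Icc 0 (G.len e), du e x = du e 0 - ∫ s in (0 : ℝ)..x, h (G.pt e s)
  kirchhoff : ∀ v, G.outgoingSum du v = 0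

theorem exists_rep {f h : G.L2} (hfh : (f, h) ∈ G.H₀.graph) :
    ∃ (u : C(G.Space, ℂ)) (du : E → ℝ → ℂ), f =ᵐ[G.vol] u ∧ G.IsKirchhoffRep u du h := by
  obtain ⟨u, du, h1, h2, h3, h4⟩ := (G.mem_graph_H₀ f h).1 hfh
  exact ⟨u, du, h1, h2, h3, h4⟩

variable {G}

theorem IsKirchhoffRep.mem_graph {u : C(G.Space, ℂ)} {du : E → ℝ → ℂ} {f h : G.L2}
    (hu : G.IsKirchhoffRep u du h) (hf : f =ᵐ[G.vol] u) : (f, h) ∈ G.H₀.graph :=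
  (G.mem_graph_H₀ f h).2 ⟨u, du, hf, hu.1, hu.2, hu.3⟩

variable {u v : C(G.Space, ℂ)} {du dv : E → ℝ → ℂ} {f f' h h' : G.L2}

theorem IsKirchhoffRep.continuousOn (hu : G.IsKirchhoffRep u du h) (e : E) :
    ContinuousOn (du e) (Icc 0 (G.len e)) := by
  have h1 := intervalIntegral.continuousOn_primitive_interval' (μ := volume)
    (G.intervalIntegrable_pt h e (G.right_mem e)) left_mem_uIcc
  rw [uIcc_of_le (G.len_pos e).le] at h1
  exact (continuousOn_const.sub h1).congr (hu.primitive e)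

variable (G) in
theorem outgoingSum_add (du dv : E → ℝ → ℂ) (v : V) :
    G.outgoingSum (du + dv) v = G.outgoingSum du v + G.outgoingSum dv v := by
  simp only [outgoingSum, ← Finset.sum_add_distrib]
  refine Finset.sum_congr rfl fun e _ => ?_
  simp only [Pi.add_apply]
  split_ifs <;> ring

variable (G) in
theorem sum_mul_outgoingSum [Fintype V] (a : V → ℂ) (du : E → ℝ → ℂ) :
    ∑ v, a v * G.outgoingSum du v =
      ∑ e, (a (G.src e) * du e 0 - a (G.tgt e) * du e (G.len e)) := by
  classical
  simp only [outgoingSum, Finset.mul_sum]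
  rw [Finset.sum_comm]
  refine Finset.sum_congr rfl fun e _ => ?_
  simp only [mul_sub, Finset.sum_sub_distrib, mul_ite, mul_zero]
  rw [Finset.sum_ite_eq, Finset.sum_ite_eq]
  simp

variable (G) in
-- Continuity gives `u` one value at all ends meeting at a vertex, so regrouping the edge ends by
-- vertex leaves that value times a vanishing Kirchhoff sum.
theorem sum_boundary_eq_zero [Finite V] (u : C(G.Space, ℂ)) {du : E → ℝ → ℂ}
    (hdu : ∀ v, G.outgoingSum du v = 0) :
    ∑ e, (u (G.pt e 0) * du e 0 - u (G.pt e (G.len e)) * du e (G.len e)) = 0 := by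
  have := Fintype.ofFinite V
  cases isEmpty_or_nonempty E
  · simp
  obtain ⟨τ, hτ⟩ := G.exists_vertex
  have h1 := G.sum_mul_outgoingSum (fun v => u (τ v)) du
  simp only [hdu, mul_zero, Finset.sum_const_zero, ← (hτ _).1, ← (hτ _).2] at h1
  exact h1.symm

theorem IsKirchhoffRep.green [Finite V] (hu : G.IsKirchhoffRep u du h)
    (hv : G.IsKirchhoffRep v dv h') (hf' : f' =ᵐ[G.vol] v) :
    inner ℂ h f' = ∑ e, ∫ s in (0 : ℝ)..G.len e, starRingEnd ℂ (du e s) * dv e s := by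
  rw [G.inner_eq_sum h f' (ae_eq_refl _) hf']
  have h1 : ∀ e, ∫ s in (0 : ℝ)..G.len e, starRingEnd ℂ (h (G.pt e s)) * v (G.pt e s) =
      (starRingEnd ℂ (du e 0) * v (G.pt e 0) -
        starRingEnd ℂ (du e (G.len e)) * v (G.pt e (G.len e))) +
      ∫ s in (0 : ℝ)..G.len e, starRingEnd ℂ (du e s) * dv e s := fun e => by
    refine integral_mul_eq_of_primitive (g := fun s => starRingEnd ℂ (h (G.pt e s)))
      (p := fun s => starRingEnd ℂ (du e s)) (v := fun s => v (G.pt e s)) (G.len_pos e).le ?_ ?_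
      (hv.hasDeriv e) (hv.continuousOn e)
    · exact (RCLike.conjCLE (K := ℂ)).toContinuousLinearMap.integrable_comp (G.integrableOn_pt h e)
    · intro x hx
      rw [hu.primitive e x hx, map_sub, ← intervalIntegral_conj]
  -- The boundary terms have the conjugate on `du` instead of `v`, so the cancellation is taken for
  -- `star v` and then conjugated.
  have h2 := congrArg (starRingEnd ℂ) (G.sum_boundary_eq_zero (star v) hu.kirchhoff)
  simp only [h1, Finset.sum_add_distrib]
  rw [add_eq_right, ← h2.trans (map_zero _), map_sum]
  refine Finset.sum_congr rfl fun e _ => ?_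
  simp [mul_comm]

theorem IsKirchhoffRep.energy [Finite V] (hu : G.IsKirchhoffRep u du h) (hf : f =ᵐ[G.vol] u) :
    inner ℂ h f = ((∑ e, ∫ s in (0 : ℝ)..G.len e, ‖du e s‖ ^ 2 : ℝ) : ℂ) := by
  have h2 : ∀ z : ℂ, starRingEnd ℂ z * z = ((‖z‖ ^ 2 : ℝ) : ℂ) := fun z => by
    rw [← Complex.normSq_eq_conj_mul_self, Complex.normSq_eq_norm_sq]
  rw [hu.green hu hf]
  simp only [h2, intervalIntegral.integral_ofReal, Complex.ofReal_sum]

theorem energy_edge_le (du : E → ℝ → ℂ) (e : E) :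
    ∫ s in (0 : ℝ)..G.len e, ‖du e s‖ ^ 2 ≤ ∑ e, ∫ s in (0 : ℝ)..G.len e, ‖du e s‖ ^ 2 :=
  Finset.single_le_sum (f := fun e => ∫ s in (0 : ℝ)..G.len e, ‖du e s‖ ^ 2)
    (fun e _ => energy_nonneg du e) (Finset.mem_univ e)

variable (G) in
theorem graph_symmetric [Finite V] (hfh : (f, h) ∈ G.H₀.graph) (hfh' : (f', h') ∈ G.H₀.graph) :
    inner ℂ h f' = inner ℂ f h' := by
  obtain ⟨u, du, hf, hu⟩ := G.exists_rep hfh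
  obtain ⟨v, dv, hf', hv⟩ := G.exists_rep hfh'
  rw [hu.green hv hf', ← inner_conj_symm, hv.green hu hf, map_sum]
  refine Finset.sum_congr rfl fun e _ => ?_
  rw [← intervalIntegral_conj]
  simp [mul_comm]

variable (G) in
theorem graph_nonneg [Finite V] (hfh : (f, h) ∈ G.H₀.graph) : 0 ≤ (inner ℂ f h).re := by
  obtain ⟨u, du, hf, hu⟩ := G.exists_rep hfh
  rw [← inner_conj_symm, hu.energy hf, Complex.conj_ofReal, Complex.ofReal_re]
  exact Finset.sum_nonneg fun e _ => energy_nonneg du e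

/-- The Sobolev inequality on a metric graph. -/
theorem IsKirchhoffRep.norm_sq_le [Finite V] (hu : G.IsKirchhoffRep u du h) (hf : f =ᵐ[G.vol] u)
    (x : G.Space) {ε : ℝ} (hε : 0 < ε) :
    ‖u x‖ ^ 2 ≤ ((∑ e, (G.len e)⁻¹) + ε) * ‖f‖ ^ 2 + ε⁻¹ * (inner ℂ h f).re := by
  obtain ⟨e, s, hs, rfl⟩ := G.exists_pt x
  rw [hu.energy hf, Complex.ofReal_re, G.norm_sq_eq_sum f hf]
  refine (norm_sq_le_sobolev (G.len_pos e) (hu.hasDeriv e) (hu.continuousOn e) hs hε).trans ?_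
  have h1 : (G.len e)⁻¹ ≤ ∑ e, (G.len e)⁻¹ :=
    Finset.single_le_sum (f := fun e => (G.len e)⁻¹) (fun e _ => (inv_pos.2 (G.len_pos e)).le)
      (Finset.mem_univ e)
  have h2 := energy_edge_le (G := G) (fun e s => u (G.pt e s)) e
  have h3 := energy_nonneg (G := G) (fun e s => u (G.pt e s)) e
  have h4 : 0 < (G.len e)⁻¹ := inv_pos.2 (G.len_pos e)
  exact add_le_add
    (mul_le_mul (add_le_add_left h1 ε) h2 h3 (by linarith))
    (mul_le_mul_of_nonneg_left (energy_edge_le du e) (inv_pos.2 hε).le)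

/-! ## The kernel of `H₀` -/

variable (G) in
theorem const_mem_graph (c : ℂ) (hf : f =ᵐ[G.vol] fun _ => c) : (f, 0) ∈ G.H₀.graph := by
  have : G.IsKirchhoffRep (ContinuousMap.const _ c) 0 0 := by
    refine ⟨fun e x _ => ?_, fun e x hx => ?_, fun v => ?_⟩
    · exact hasDerivWithinAt_const x _ c
    · rw [G.integral_pt_congr (Lp.coeFn_zero ℂ 2 G.vol) e hx]
      simp
    · simp [outgoingSum]
  exact this.mem_graph hf

/-- With `h = 0` the derivative is constant on each edge, and zero energy makes that constant
vanish; connectedness links the values at the vertices. -/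
theorem IsKirchhoffRep.eq_const [Finite V] [Nonempty E] (hG : G.Connected)
    (hu : G.IsKirchhoffRep u du 0) : ∃ c, ∀ x, u x = c := by
  have hf := ContinuousMap.coeFn_toLp (p := 2) (𝕜 := ℂ) G.vol u
  have h0 := hu.energy hf
  rw [inner_zero_left, eq_comm, Complex.ofReal_eq_zero,
    Finset.sum_eq_zero_iff_of_nonneg fun e _ => energy_nonneg du e] at h0
  have hdu : ∀ e, ∀ x ∈ Icc 0 (G.len e), du e x = du e 0 := fun e x hx => by
    rw [hu.primitive e x hx, G.integral_pt_congr (Lp.coeFn_zero ℂ 2 G.vol) e hx]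
    simp
  have hdu0 : ∀ e, du e 0 = 0 := fun e => by
    have h1 := h0 e (Finset.mem_univ e)
    have h2 : ∫ s in (0 : ℝ)..G.len e, ‖du e s‖ ^ 2 = ∫ _ in (0 : ℝ)..G.len e, ‖du e 0‖ ^ 2 := by
      refine intervalIntegral.integral_congr fun s hs => ?_
      rw [uIcc_of_le (G.len_pos e).le] at hs
      simp only [hdu e s hs]
    rw [h2, intervalIntegral.integral_const] at h1
    simpa [(G.len_pos e).ne'] using h1
  have hedge : ∀ e, ∀ x ∈ Icc 0 (G.len e), u (G.pt e x) = u (G.pt e 0) := fun e x hx => by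
    have h1 := integral_eq_sub_of_hasDerivWithinAt_Icc (hu.hasDeriv e) (hu.continuousOn e)
      (G.left_mem e) hx hx.1
    have h2 : ∫ s in (0 : ℝ)..x, du e s = ∫ _ in (0 : ℝ)..x, (0 : ℂ) := by
      refine intervalIntegral.integral_congr fun s hs => ?_
      rw [uIcc_of_le hx.1] at hs
      rw [hdu e s ⟨hs.1, hs.2.trans hx.2⟩, hdu0]
    rw [h2, intervalIntegral.integral_zero] at h1
    exact sub_eq_zero.1 h1.symm
  obtain ⟨τ, hτ⟩ := G.exists_vertex
  have hconn : ∀ v w, u (τ v) = u (τ w) := fun v w => by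
    induction hG v w with
    | rel a b hab =>
      obtain ⟨e, rfl, rfl⟩ := hab
      rw [← (hτ e).1, ← (hτ e).2, hedge e _ (G.right_mem e)]
    | refl => rfl
    | symm a b _ ih => exact ih.symm
    | trans a b c _ _ ih1 ih2 => exact ih1.trans ih2
  let e₀ : E := Classical.arbitrary E
  refine ⟨u (τ (G.src e₀)), fun x => ?_⟩
  obtain ⟨e, s, hs, rfl⟩ := G.exists_pt x
  rw [hedge e s hs, (hτ e).1]
  exact hconn _ _

variable (G) in
theorem mem_graph_zero_iff [Finite V] [Nonempty E] (hG : G.Connected) :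
    (f, 0) ∈ G.H₀.graph ↔ ∃ c : ℂ, f =ᵐ[G.vol] fun _ => c := by
  constructor
  · intro hf
    obtain ⟨u, du, hf, hu⟩ := G.exists_rep hf
    obtain ⟨c, hc⟩ := hu.eq_const hG
    exact ⟨c, hf.trans (Eventually.of_forall hc)⟩
  · rintro ⟨c, hc⟩
    exact G.const_mem_graph c hc

/-! ## Solvability -/

variable (G) in
/-- The Poisson equation for the weighted Laplacian of the underlying finite graph. -/
theorem exists_laplacian_eq [Fintype V] [Nonempty E] (hG : G.Connected) (r : V → ℂ)
    (hr : ∑ v, r v = 0) :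
    ∃ c : V → ℂ, ∀ v,
      G.outgoingSum (fun e _ => (c (G.tgt e) - c (G.src e)) / G.len e) v = r v := by
  let D : (V → ℂ) → E → ℝ → ℂ := fun c e _ => (c (G.tgt e) - c (G.src e)) / G.len e
  -- The Laplacian has the constants as kernel; adding the total sum `∑ w, c w` removes it, so in
  -- finite dimension injectivity yields surjectivity. For right-hand sides of sum zero the added
  -- term vanishes.
  let L : (V → ℂ) →ₗ[ℂ] V → ℂ :=
    { toFun := fun c v => G.outgoingSum (D c) v + ∑ w, c w
      map_add' := fun c d => by
        ext v
        have : D (c + d) = D c + D d := by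
          ext e s
          simp only [D, Pi.add_apply]
          ring
        simp only [this, outgoingSum_add, Pi.add_apply, Finset.sum_add_distrib]
        exact add_add_add_comm _ _ _ _
      map_smul' := fun a c => by
        ext v
        have : D (a • c) = a • D c := by
          ext e s
          simp only [D, Pi.smul_apply, smul_eq_mul]
          ring
        simp only [this, outgoingSum, Pi.smul_apply, smul_eq_mul, RingHom.id_apply, mul_add,
          Finset.mul_sum]
        refine congrArg₂ (· + ·) (Finset.sum_congr rfl fun e _ => ?_) rfl
        split_ifs <;> ring }
  have hLapp : ∀ c v, L c v = G.outgoingSum (D c) v + ∑ w, c w := fun _ _ => rfl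
  have hV : Nonempty V := ⟨G.src (Classical.arbitrary E)⟩
  have hsum : ∀ c, ∑ v : V, L c v = 0 → ∑ w : V, c w = 0 := fun c hc => by
    have h1 := G.sum_mul_outgoingSum (fun _ => 1) (D c)
    simp only [one_mul, D, sub_self, Finset.sum_const_zero] at h1
    simp only [hLapp, Finset.sum_add_distrib, D, h1, zero_add, Finset.sum_const,
      smul_eq_zero, Finset.card_univ, Fintype.card_ne_zero, false_or] at hc
    exact hc
  have hinj : Function.Injective L := by
    refine (injective_iff_map_eq_zero L).2 fun c hc => ?_
    have hc' : ∀ v, L c v = 0 := fun v => by rw [hc]; rfl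
    have h0 : ∑ w, c w = 0 := hsum c (by simp [hc'])
    have hout : ∀ v, G.outgoingSum (D c) v = 0 := fun v => by
      have := hc' v
      rwa [hLapp, h0, add_zero] at this
    -- Pairing with the conjugate of `c` produces minus the discrete Dirichlet energy, a sum of
    -- terms of one sign.
    have h1 := G.sum_mul_outgoingSum (fun v => starRingEnd ℂ (c v)) (D c)
    simp only [hout, mul_zero, Finset.sum_const_zero] at h1
    have h2 : ∀ e, starRingEnd ℂ (c (G.src e)) * D c e 0 -
        starRingEnd ℂ (c (G.tgt e)) * D c e (G.len e) =
        ((-(‖c (G.tgt e) - c (G.src e)‖ ^ 2 / G.len e) : ℝ) : ℂ) := fun e => by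
      rw [← Complex.normSq_eq_norm_sq]
      push_cast
      rw [Complex.normSq_eq_conj_mul_self, map_sub]
      simp only [D]
      ring
    simp only [h2, ← Complex.ofReal_sum] at h1
    rw [eq_comm, Complex.ofReal_eq_zero, Finset.sum_neg_distrib, neg_eq_zero,
      Finset.sum_eq_zero_iff_of_nonneg fun e _ => div_nonneg (by positivity) (G.len_pos e).le] at h1
    have hedge : ∀ e, c (G.src e) = c (G.tgt e) := fun e => by
      have := h1 e (Finset.mem_univ e)
      rw [div_eq_zero_iff, or_iff_left (G.len_pos e).ne', sq_eq_zero_iff, norm_eq_zero,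
        sub_eq_zero] at this
      exact this.symm
    have hconn : ∀ v w, c v = c w := fun v w => by
      induction hG v w with
      | rel a b hab =>
        obtain ⟨e, rfl, rfl⟩ := hab
        exact hedge e
      | refl => rfl
      | symm a b _ ih => exact ih.symm
      | trans a b c _ _ ih1 ih2 => exact ih1.trans ih2
    ext v
    simp only [hconn _ v, Finset.sum_const, smul_eq_zero, Finset.card_univ, Fintype.card_ne_zero,
      false_or] at h0
    exact h0
  obtain ⟨c, hc⟩ := LinearMap.injective_iff_surjective.1 hinj r
  refine ⟨c, fun v => ?_⟩
  have h0 : ∑ w : V, c w = 0 := hsum c (by rw [hc, hr])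
  have := congrFun hc v
  rwa [hLapp, h0, add_zero] at this

variable (G) in
-- Two integrations solve the equation on each edge with prescribed end values; the Kirchhoff
-- conditions become a graph Poisson equation for the vertex values, whose solvability condition is
-- the vanishing of the integral of `h`.
theorem exists_mem_graph [Finite V] [Nonempty E] (hG : G.Connected) (h : G.L2)
    (hh : ∑ e, ∫ s in (0 : ℝ)..G.len e, h (G.pt e s) = 0) : ∃ f, (f, h) ∈ G.H₀.graph := by
  have := Fintype.ofFinite V
  -- Extension by zero makes `g e` integrable on the whole line, so its primitives are continuous
  -- there and the second primitive is differentiable without care at the ends.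
  let g : E → ℝ → ℂ := fun e => (Icc 0 (G.len e)).indicator fun s => h (G.pt e s)
  have hg : ∀ e, Integrable (g e) := fun e =>
    (integrable_indicator_iff measurableSet_Icc).2 (G.integrableOn_pt h e)
  let P : E → ℝ → ℂ := fun e x => ∫ s in (0 : ℝ)..x, g e s
  have hP : ∀ e, Continuous (P e) := fun e =>
    intervalIntegral.continuous_primitive (fun a b => (hg e).intervalIntegrable) 0
  have hPeq : ∀ e, ∀ x ∈ Icc 0 (G.len e), P e x = ∫ s in (0 : ℝ)..x, h (G.pt e s) := fun e x hx => by
    refine intervalIntegral.integral_congr fun s hs => ?_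
    rw [uIcc_of_le hx.1] at hs
    exact Set.indicator_of_mem (s := Icc 0 (G.len e)) ⟨hs.1, hs.2.trans hx.2⟩
      fun s => h (G.pt e s)
  let Q : E → ℝ → ℂ := fun e x => ∫ s in (0 : ℝ)..x, P e s
  have hQ : ∀ e x, HasDerivAt (Q e) (P e x) x := fun e x =>
    ((hP e).integral_hasStrictDerivAt 0 x).hasDerivAt
  have hQ0 : ∀ e, Q e 0 = 0 := fun e => intervalIntegral.integral_same
  have hP0 : ∀ e, P e 0 = 0 := fun e => intervalIntegral.integral_same
  have hl : ∀ e, (G.len e : ℂ) ≠ 0 := fun e => by exact_mod_cast (G.len_pos e).ne'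
  -- The derivative of the particular solution `x ↦ (Q e ℓ / ℓ) x - Q e x`, which vanishes at both
  -- ends of the edge.
  let d : E → ℝ → ℂ := fun e x => Q e (G.len e) / G.len e - P e x
  have hd : ∑ v : V, -G.outgoingSum d v = 0 := by
    have h1 := G.sum_mul_outgoingSum (fun _ => 1) d
    simp only [one_mul] at h1
    rw [Finset.sum_neg_distrib, h1, neg_eq_zero, ← hh]
    refine Finset.sum_congr rfl fun e _ => ?_
    simp only [d]
    rw [hP0, ← hPeq e _ (G.right_mem e)]
    ring
  obtain ⟨c, hc⟩ := G.exists_laplacian_eq hG _ hd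
  let B : E → ℂ := fun e => (c (G.tgt e) - c (G.src e)) / G.len e + Q e (G.len e) / G.len e
  let w : E → ℝ → ℂ := fun e x => c (G.src e) + B e * x - Q e x
  have hw : ∀ e x, HasDerivAt (w e) (B e - P e x) x := fun e x => by
    have h1 : HasDerivAt (fun x : ℝ => (x : ℂ)) 1 x := Complex.ofRealCLM.hasDerivAt
    have h2 := ((h1.const_mul (B e)).const_add (c (G.src e))).sub (hQ e x)
    rwa [mul_one] at h2
  obtain ⟨u, hu⟩ := G.exists_glue w c
    (fun e => (continuous_iff_continuousAt.2 fun x => (hw e x).continuousAt).continuousOn)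
    (fun e => by simp [w, hQ0])
    (fun e => by
      simp only [w, B]
      field_simp [hl e]
      ring)
  have hrep : G.IsKirchhoffRep u (fun e x => B e - P e x) h := by
    refine ⟨fun e x hx => ?_, fun e x hx => ?_, fun v => ?_⟩
    · exact (hw e x).hasDerivWithinAt.congr (hu e) (hu e x hx)
    · rw [hP0, hPeq e x hx, sub_zero]
    · have h1 : G.outgoingSum (fun e x => B e - P e x) v =
          G.outgoingSum (fun e _ => (c (G.tgt e) - c (G.src e)) / G.len e) v +
            G.outgoingSum d v := by
        rw [← outgoingSum_add]
        congr 1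
        ext e x
        simp only [B, d, Pi.add_apply]
        ring
      rw [h1, hc, neg_add_cancel]
  exact ⟨_, hrep.mem_graph (ContinuousMap.coeFn_toLp (p := 2) (𝕜 := ℂ) G.vol u)⟩

end QuantumGraph

/-! ## The minimum principle -/

/-- One form covers a minimum in the interior, where `D` vanishes, and at an end, where only the
sign of the one-sided derivative is known. -/
theorem mul_sub_nonneg_of_isMinOn_Icc {f : ℝ → ℝ} {D a b s : ℝ} (hs : s ∈ Icc a b)
    (hmin : ∀ y ∈ Icc a b, f s ≤ f y) (hf : HasDerivWithinAt f D (Icc a b) s) {y : ℝ}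
    (hy : y ∈ Icc a b) : 0 ≤ D * (y - s) := by
  have h1 : IsLocalMinOn f (Icc a b) s := Filter.eventually_of_mem self_mem_nhdsWithin hmin
  have h2 : y - s ∈ posTangentConeAt (Icc a b) s := by
    refine sub_mem_posTangentConeAt_of_segment_subset ?_
    exact (convex_Icc a b).segment_subset hs hy
  have h3 := h1.hasFDerivWithinAt_nonneg hf.hasFDerivWithinAt h2
  simpa [mul_comm] using h3

namespace QuantumGraph

variable {V E : Type*} (G : QuantumGraph V E)

/-- The elements of `L²` whose real component selected by `l` is non-negative. -/
def nonnegSet (l : ℂ →L[ℝ] ℝ) : Set G.L2 := {f | ∀ᵐ x ∂G.vol, 0 ≤ l (f x)}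

variable {G}

/-! ### Equicontinuity from a modulus along the edges, and closed and compact sets of functions -/

theorem exists_delta_of_modulus (Q : ℝ) {η : ℝ} (hη : 0 < η) :
    ∃ ε > 0, ∃ δ > 0, ∀ r : ℝ, |r| < δ → ε * Q + ε⁻¹ * |r| < η := by
  refine ⟨η / 2 / (|Q| + 1), by positivity, η / 2 * (η / 2 / (|Q| + 1)), by positivity,
    fun r hr => ?_⟩
  have h1 : η / 2 / (|Q| + 1) * Q ≤ η / 2 := by
    rw [div_mul_eq_mul_div, div_le_iff₀ (by positivity)]
    have := le_abs_self Q
    gcongr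
    linarith
  have h2 : (η / 2 / (|Q| + 1))⁻¹ * |r| < η / 2 := by
    rw [inv_mul_lt_iff₀ (by positivity), mul_comm]
    exact hr
  linarith

/-- Equicontinuity is continuity of one map into a space of uniform functions, so it can be checked
on the edges through the quotient map. -/
theorem equicontinuous_of_modulus {ι : Type*} (F : ι → G.Space → ℂ) (Q : ℝ)
    (hF : ∀ i, ∀ ε : ℝ, 0 < ε → ∀ e, ∀ s ∈ Icc 0 (G.len e), ∀ t ∈ Icc 0 (G.len e),
      ‖F i (G.pt e t) - F i (G.pt e s)‖ ≤ ε * Q + ε⁻¹ * |t - s|) : Equicontinuous F := by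
  rw [equicontinuous_iff_continuous]
  refine (isQuotientMap_quot_mk (X := G.Edges)).continuous_iff.2 (continuous_sigma fun e => ?_)
  have hE : Equicontinuous fun (i : ι) (s : Icc 0 (G.len e)) => F i (G.pt e s) := by
    intro s
    rw [Metric.equicontinuousAt_iff]
    intro η hη
    obtain ⟨ε, hε, δ, hδ, hεδ⟩ := exists_delta_of_modulus Q hη
    refine ⟨δ, hδ, fun t ht i => ?_⟩
    rw [dist_comm, dist_eq_norm]
    rw [Subtype.dist_eq, Real.dist_eq] at ht
    exact (hF i ε hε e s s.2 t t.2).trans_lt (hεδ _ ht)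
  rw [equicontinuous_iff_continuous] at hE
  convert hE using 1
  funext s
  refine congrArg (fun x => UniformFun.ofFun fun i => F i x) ?_
  exact (G.pt_of_mem s.2).symm

/-- An `L²`-convergent sequence has an almost everywhere convergent subsequence. -/
theorem isClosed_nonnegSet (l : ℂ →L[ℝ] ℝ) : IsClosed (G.nonnegSet l) := by
  refine IsSeqClosed.isClosed fun f g hf hfg => ?_
  have h1 := tendstoInMeasure_of_tendsto_Lp hfg
  obtain ⟨ns, -, hns⟩ := h1.exists_seq_tendsto_ae
  have h2 : ∀ᵐ x ∂G.vol, ∀ n, 0 ≤ l (f n x) := ae_all_iff.2 fun n => hf n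
  change ∀ᵐ x ∂G.vol, 0 ≤ l (g x)
  filter_upwards [hns, h2] with x hx hx'
  exact ge_of_tendsto ((l.continuous.tendsto _).comp hx) (Eventually.of_forall fun n => hx' _)

variable (G) in
/-- The continuous functions with a given bound and a given modulus of continuity. -/
def equicontinuousSet (B Q : ℝ) : Set C(G.Space, ℂ) :=
  {u | (∀ x, ‖u x‖ ≤ B) ∧ ∀ ε : ℝ, 0 < ε → ∀ e, ∀ s ∈ Icc 0 (G.len e), ∀ t ∈ Icc 0 (G.len e),
    ‖u (G.pt e t) - u (G.pt e s)‖ ≤ ε * Q + ε⁻¹ * |t - s|}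

theorem isCompact_equicontinuousSet (B Q : ℝ) : IsCompact (G.equicontinuousSet B Q) := by
  refine ArzelaAscoli.isCompact_of_equicontinuous _ ?_
    (equicontinuous_of_modulus _ Q fun u => u.2.2)
  have hpi : IsCompact (univ.pi fun _ : G.Space => Metric.closedBall (0 : ℂ) B) :=
    isCompact_univ_pi fun _ => isCompact_closedBall 0 B
  let W : Set (G.Space → ℂ) := {w | ∀ ε : ℝ, 0 < ε → ∀ e, ∀ s ∈ Icc 0 (G.len e),
    ∀ t ∈ Icc 0 (G.len e), ‖w (G.pt e t) - w (G.pt e s)‖ ≤ ε * Q + ε⁻¹ * |t - s|}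
  have hW : IsClosed W := by
    simp only [W, ofPred_forall]
    refine isClosed_iInter fun ε => isClosed_iInter fun _ => isClosed_iInter fun e =>
      isClosed_iInter fun s => isClosed_iInter fun _ => isClosed_iInter fun t =>
      isClosed_iInter fun _ => ?_
    exact isClosed_le (by fun_prop) continuous_const
  -- The bound and the modulus are closed conditions for pointwise convergence, and the modulus
  -- forces continuity of any limit; Tychonoff gives the compactness that Arzelà–Ascoli asks for.
  convert hpi.inter_right hW using 1
  ext w
  constructor
  · rintro ⟨u, hu, rfl⟩
    exact ⟨fun x _ => by simpa using hu.1 x, hu.2⟩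
  · rintro ⟨h1, h2⟩
    have hw : Continuous w :=
      (equicontinuous_of_modulus (fun _ : Unit => w) Q fun _ => h2).continuous ()
    exact ⟨⟨w, hw⟩, ⟨fun x => by simpa using h1 x (mem_univ x), h2⟩, rfl⟩

/-! ### The minimum principle on the graph and positivity of resolvents -/

variable [Fintype E]
variable {u : C(G.Space, ℂ)} {du : E → ℝ → ℂ} {f h : G.L2}

/-- In the interior of an edge this is Fermat's rule. At a vertex all outgoing derivatives are
non-negative and sum to zero, so each of them vanishes. -/
theorem IsKirchhoffRep.deriv_eq_zero_of_isMin [Nonempty E] (hu : G.IsKirchhoffRep u du h)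
    (l : ℂ →L[ℝ] ℝ) {x₀ : G.Space} (hmin : ∀ x, l (u x₀) ≤ l (u x)) {e : E} {s : ℝ}
    (hs : s ∈ Icc 0 (G.len e)) (hx₀ : x₀ = G.pt e s) : l (du e s) = 0 := by
  obtain ⟨τ, hτ⟩ := G.exists_vertex
  have hsign : ∀ e, ∀ s ∈ Icc 0 (G.len e), x₀ = G.pt e s → ∀ y ∈ Icc 0 (G.len e),
      0 ≤ l (du e s) * (y - s) := fun e s hs hx₀ y hy => by
    refine mul_sub_nonneg_of_isMinOn_Icc (f := fun s => l (u (G.pt e s))) hs (fun y _ => ?_)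
      (l.hasFDerivAt.comp_hasDerivWithinAt s (hu.hasDeriv e s hs)) hy
    rw [← hx₀]
    exact hmin _
  have hsrc : ∀ e, x₀ = τ (G.src e) → 0 ≤ l (du e 0) := fun e he => by
    have := hsign e 0 (G.left_mem e) (he.trans (hτ e).1.symm) _ (G.right_mem e)
    rw [sub_zero] at this
    exact nonneg_of_mul_nonneg_left this (G.len_pos e)
  have htgt : ∀ e, x₀ = τ (G.tgt e) → l (du e (G.len e)) ≤ 0 := fun e he => by
    have := hsign e _ (G.right_mem e) (he.trans (hτ e).2.symm) 0 (G.left_mem e)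
    have h1 := G.len_pos e
    by_contra! hlt
    nlinarith
  have hvert : ∀ v, x₀ = τ v → ∀ e, (G.src e = v → l (du e 0) = 0) ∧
      (G.tgt e = v → l (du e (G.len e)) = 0) := fun v hv => by
    classical
    have h1 : ∑ e, ((if G.src e = v then l (du e 0) else 0) -
        (if G.tgt e = v then l (du e (G.len e)) else 0)) = 0 := by
      have := congrArg l (hu.kirchhoff v)
      rw [outgoingSum, map_sum, map_zero] at this
      refine Eq.trans (Finset.sum_congr rfl fun e _ => ?_) this
      split_ifs <;> simp
    have ha : ∀ e, 0 ≤ if G.src e = v then l (du e 0) else 0 := fun e => by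
      split_ifs with h
      · exact hsrc e (hv.trans (by rw [h]))
      · exact le_rfl
    have hb : ∀ e, (if G.tgt e = v then l (du e (G.len e)) else 0) ≤ 0 := fun e => by
      split_ifs with h
      · exact htgt e (hv.trans (by rw [h]))
      · exact le_rfl
    rw [Finset.sum_eq_zero_iff_of_nonneg fun e _ => sub_nonneg.2 ((hb e).trans (ha e))] at h1
    intro e
    have h2 := h1 e (Finset.mem_univ e)
    refine ⟨fun h => ?_, fun h => ?_⟩
    · have := ha e
      have := hb e
      rw [if_pos h] at *
      linarith
    · have := ha e
      have := hb e
      rw [if_pos h] at *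
      linarith
  rcases eq_or_lt_of_le hs.1 with rfl | h0
  · exact (hvert _ (hx₀.trans (hτ e).1) e).1 rfl
  rcases eq_or_lt_of_le hs.2 with rfl | h1
  · exact (hvert _ (hx₀.trans (hτ e).2) e).2 rfl
  · have h2 := hsign e s hs hx₀ _ (G.left_mem e)
    have h3 := hsign e s hs hx₀ _ (G.right_mem e)
    nlinarith

/-- The minimum principle: if `-w'' + a w ≥ 0` with `a > 0`, then `w ≥ 0`, where `w` is a real
component of `u`. -/
theorem IsKirchhoffRep.nonneg_of_ae_le [Nonempty E] (hu : G.IsKirchhoffRep u du h)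
    (l : ℂ →L[ℝ] ℝ) {a : ℝ} (ha : 0 < a) (hle : ∀ᵐ x ∂G.vol, -(a * l (u x)) ≤ l (h x))
    (x : G.Space) : 0 ≤ l (u x) := by
  obtain ⟨x₀, -, hx₀⟩ := isCompact_univ.exists_isMinOn (univ_nonempty (α := G.Space))
    (l.continuous.comp u.continuous).continuousOn
  have hmin : ∀ x, l (u x₀) ≤ l (u x) := fun x => hx₀ (mem_univ x)
  refine le_trans ?_ (hmin x)
  by_contra! hneg
  obtain ⟨e, s, hs, hx₀s⟩ := G.exists_pt x₀
  have hD := hu.deriv_eq_zero_of_isMin l hmin hs hx₀s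
  have hcont : Continuous fun y => l (u (G.pt e y)) :=
    l.continuous.comp (u.continuous.comp (G.continuous_pt e))
  have hnear : ∀ᶠ y in 𝓝 s, l (u (G.pt e y)) < l (u x₀) / 2 := by
    refine hcont.continuousAt.eventually_lt continuousAt_const ?_
    rw [← hx₀s]
    linarith
  obtain ⟨δ, hδ, hball⟩ := Metric.eventually_nhds_iff.1 hnear
  -- Near a negative minimum `-w'' ≥ -a w > 0`, so `w'` is strictly decreasing. As `w'` vanishes at
  -- the minimum, `w` would drop below its minimum nearby.
  have hanti : ∀ y ∈ Icc 0 (G.len e), ∀ z ∈ Icc 0 (G.len e), |y - s| < δ → |z - s| < δ → y < z →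
      l (du e z) < l (du e y) := fun y hy z hz hyδ hzδ hyz => by
    have hint : IntervalIntegrable (fun t => h (G.pt e t)) volume y z :=
      (G.intervalIntegrable_pt h e hy).symm.trans (G.intervalIntegrable_pt h e hz)
    have h1 : du e y - du e z = ∫ t in y..z, h (G.pt e t) := by
      rw [hu.primitive e y hy, hu.primitive e z hz, ← intervalIntegral.integral_add_adjacent_intervals
        (G.intervalIntegrable_pt h e hy) hint]
      ring
    have h2 : l (du e y) - l (du e z) = ∫ t in y..z, l (h (G.pt e t)) := by
      rw [← map_sub, h1, ContinuousLinearMap.intervalIntegral_comp_comm l hint]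
    have h3 : ∫ _ in y..z, -(a * (l (u x₀) / 2)) ≤ ∫ t in y..z, l (h (G.pt e t)) := by
      refine intervalIntegral.integral_mono_ae_restrict hyz.le intervalIntegrable_const
        ⟨l.integrable_comp hint.1, l.integrable_comp hint.2⟩ ?_
      have h4 := (ae_restrict_iff' measurableSet_Icc).1 (G.ae_pt hle e)
      rw [EventuallyLE, ae_restrict_iff' measurableSet_Icc]
      filter_upwards [h4] with t ht htyz
      refine le_trans ?_ (ht ⟨hy.1.trans htyz.1, htyz.2.trans hz.2⟩)
      have h5 : |t - s| < δ := by
        rw [abs_lt] at hyδ hzδ ⊢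
        constructor <;> linarith [htyz.1, htyz.2]
      have h6 := hball (y := t) (by rwa [Real.dist_eq])
      have h7 := mul_le_mul_of_nonneg_left h6.le ha.le
      linarith
    rw [intervalIntegral.integral_const, smul_eq_mul, ← h2] at h3
    have h4 : 0 < (z - y) * -(a * (l (u x₀) / 2)) :=
      mul_pos (sub_pos.2 hyz) (by have := mul_neg_of_pos_of_neg ha hneg; linarith)
    linarith
  have hslope : ∀ y ∈ Icc 0 (G.len e), ∀ z ∈ Icc 0 (G.len e), y < z →
      ∃ ξ ∈ Ioo y z, l (du e ξ) * (z - y) = l (u (G.pt e z)) - l (u (G.pt e y)) :=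
    fun y hy z hz hyz => by
    obtain ⟨ξ, hξ, heq⟩ := exists_hasDerivAt_eq_slope (fun t => l (u (G.pt e t)))
      (fun t => l (du e t)) hyz hcont.continuousOn fun t ht =>
        l.hasFDerivAt.comp_hasDerivAt t ((hu.hasDeriv e t ⟨hy.1.trans ht.1.le,
          ht.2.le.trans hz.2⟩).hasDerivAt (Icc_mem_nhds (hy.1.trans_lt ht.1) (ht.2.trans_le hz.2)))
    refine ⟨ξ, hξ, ?_⟩
    rw [heq, div_mul_cancel₀ _ (sub_pos.2 hyz).ne']
  -- Move to the right of `s`, or to the left when `s` is the right end; one such direction always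
  -- exists within the edge.
  rcases lt_or_ge s (G.len e) with hlt | hge
  · let z := min (G.len e) (s + δ / 2)
    have hsz : s < z := lt_min hlt (by linarith)
    have hzδ : z ≤ s + δ / 2 := min_le_right _ _
    have hz : z ∈ Icc 0 (G.len e) := ⟨hs.1.trans hsz.le, min_le_left _ _⟩
    obtain ⟨ξ, hξ, heq⟩ := hslope s hs z hz hsz
    have h1 := hanti s hs ξ ⟨hs.1.trans hξ.1.le, hξ.2.le.trans hz.2⟩ (by simpa using hδ)
      (by rw [abs_lt]; constructor <;> linarith [hξ.1, hξ.2]) hξ.1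
    rw [hD] at h1
    have h2 := mul_neg_of_neg_of_pos h1 (sub_pos.2 hsz)
    have h3 := hmin (G.pt e z)
    rw [heq, ← hx₀s] at h2
    linarith
  · have hpos : 0 < s := (G.len_pos e).trans_le hge
    let y := max 0 (s - δ / 2)
    have hys : y < s := max_lt hpos (by linarith)
    have hyδ : s - δ / 2 ≤ y := le_max_right _ _
    have hy : y ∈ Icc 0 (G.len e) := ⟨le_max_left _ _, hys.le.trans hs.2⟩
    obtain ⟨ξ, hξ, heq⟩ := hslope y hy s hs hys
    have h1 := hanti ξ ⟨hy.1.trans hξ.1.le, hξ.2.le.trans hs.2⟩ s hs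
      (by rw [abs_lt]; constructor <;> linarith [hξ.1, hξ.2]) (by simpa using hδ) hξ.2
    rw [hD] at h1
    have h2 := mul_pos h1 (sub_pos.2 hys)
    have h3 := hmin (G.pt e y)
    rw [heq, ← hx₀s] at h2
    linarith

theorem mem_nonnegSet_of_resolvent [Nonempty E] (l : ℂ →L[ℝ] ℝ) {a : ℝ} (ha : 0 < a) {f g : G.L2}
    (hg : g ∈ G.nonnegSet l) (hfg : (f, (a : ℂ) • (g - f)) ∈ G.H₀.graph) : f ∈ G.nonnegSet l := by
  obtain ⟨u, du, hf, hu⟩ := G.exists_rep hfg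
  have h1 : ∀ᵐ x ∂G.vol, -(a * l (u x)) ≤ l (((a : ℂ) • (g - f) : G.L2) x) := by
    filter_upwards [hg, hf, Lp.coeFn_smul (a : ℂ) (g - f), Lp.coeFn_sub g f] with x h1 h2 h3 h4
    rw [h3, Pi.smul_apply, h4, Pi.sub_apply, h2, Complex.coe_smul, map_smul, map_sub, smul_eq_mul,
      mul_sub]
    have := mul_nonneg ha.le h1
    linarith
  have h2 := hu.nonneg_of_ae_le l ha h1
  change ∀ᵐ x ∂G.vol, 0 ≤ l (f x)
  filter_upwards [hf] with x hx
  rw [hx]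
  exact h2 x

/-! ## Compactness -/

theorem IsKirchhoffRep.mem_equicontinuousSet [Finite V] (hu : G.IsKirchhoffRep u du h)
    (hf : f =ᵐ[G.vol] u) {C : ℝ} (hh : ‖h‖ ≤ 1) (hC : ‖f‖ ≤ C) :
    u ∈ G.equicontinuousSet (Real.sqrt (((∑ e, (G.len e)⁻¹) + 1) * C ^ 2 + C)) C := by
  have hQ : (inner ℂ h f).re ≤ C :=
    (Complex.re_le_norm _).trans ((norm_inner_le_norm h f).trans
      ((mul_le_of_le_one_left (norm_nonneg _) hh).trans hC))
  have hQ' := hu.energy hf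
  refine ⟨fun x => Real.le_sqrt_of_sq_le ?_, fun ε hε e s hs t ht => ?_⟩
  · refine (hu.norm_sq_le hf x one_pos).trans ?_
    rw [inv_one, one_mul]
    have h0 : 0 ≤ ∑ e, (G.len e)⁻¹ :=
      Finset.sum_nonneg fun e _ => (inv_pos.2 (G.len_pos e)).le
    gcongr
  · refine (norm_sub_le_of_energy (hu.hasDeriv e) (hu.continuousOn e) hs ht hε).trans ?_
    rw [hQ', Complex.ofReal_re] at hQ
    have := energy_edge_le (G := G) du e
    gcongr
    exact this.trans hQ

variable (G) in
theorem exists_isCompact_of_graph [Finite V] (C : ℝ) :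
    ∃ K : Set G.L2, IsCompact K ∧
      ∀ f h, (f, h) ∈ G.H₀.graph → ‖h‖ ≤ 1 → ‖f‖ ≤ C → f ∈ K := by
  refine ⟨ContinuousMap.toLp 2 G.vol ℂ '' _, (isCompact_equicontinuousSet
    (G := G) (Real.sqrt (((∑ e, (G.len e)⁻¹) + 1) * C ^ 2 + C)) C).image
      (ContinuousMap.toLp 2 G.vol ℂ).continuous, fun f h hfh hh hC => ?_⟩
  obtain ⟨u, du, hf, hu⟩ := G.exists_rep hfh
  refine ⟨u, hu.mem_equicontinuousSet hf hh hC, Lp.ext ?_⟩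
  exact (ContinuousMap.coeFn_toLp (p := 2) (𝕜 := ℂ) G.vol u).trans hf.symm

/-! ## Diagonalization -/

variable (G) in
/-- The normalized constant function. -/
def unitConst : G.L2 :=
  ContinuousMap.toLp 2 G.vol ℂ
    (ContinuousMap.const _ ((G.vol.real univ ^ (-(1 / 2) : ℝ) : ℝ) : ℂ))

theorem coeFn_unitConst :
    G.unitConst =ᵐ[G.vol] fun _ => ((G.vol.real univ ^ (-(1 / 2) : ℝ) : ℝ) : ℂ) :=
  ContinuousMap.coeFn_toLp (p := 2) (𝕜 := ℂ) G.vol _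

theorem vol_real_univ_pos [Nonempty E] : 0 < G.vol.real univ := by
  rw [measureReal_def]
  exact ENNReal.toReal_pos (isOpen_univ.measure_pos G.vol univ_nonempty).ne' (measure_ne_top _ _)

theorem norm_unitConst [Nonempty E] : ‖G.unitConst‖ = 1 := by
  have h0 := vol_real_univ_pos (G := G)
  have h1 : inner ℂ G.unitConst G.unitConst = (1 : ℂ) := by
    rw [L2.inner_def]
    have h2 : (fun x => inner ℂ (G.unitConst x) (G.unitConst x)) =ᵐ[G.vol] fun _ =>
        (((G.vol.real univ)⁻¹ : ℝ) : ℂ) := by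
      filter_upwards [G.coeFn_unitConst] with x hx
      rw [hx, RCLike.inner_apply, Complex.conj_ofReal, ← Complex.ofReal_mul, ← Real.rpow_add h0]
      norm_num [Real.rpow_neg_one]
    rw [integral_congr_ae h2, integral_const, Complex.real_smul, ← Complex.ofReal_mul,
      mul_inv_cancel₀ h0.ne', Complex.ofReal_one]
  rw [inner_self_eq_norm_sq_to_K] at h1
  have h2 : ‖G.unitConst‖ ^ 2 = 1 := Complex.ofReal_injective (by
    rw [Complex.ofReal_one, ← h1]
    push_cast
    rfl)
  exact (pow_eq_one_iff_of_nonneg (norm_nonneg _) two_ne_zero).1 h2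

theorem unitConst_value_ne_zero [Nonempty E] :
    ((G.vol.real univ ^ (-(1 / 2) : ℝ) : ℝ) : ℂ) ≠ 0 := by
  exact_mod_cast (Real.rpow_pos_of_pos vol_real_univ_pos _).ne'

theorem mem_span_unitConst [Nonempty E] {c : ℂ} (hf : f =ᵐ[G.vol] fun _ => c) :
    f ∈ Submodule.span ℂ {G.unitConst} := by
  refine Submodule.mem_span_singleton.2
    ⟨c / ((G.vol.real univ ^ (-(1 / 2) : ℝ) : ℝ) : ℂ), Lp.ext ?_⟩
  filter_upwards [hf, G.coeFn_unitConst, Lp.coeFn_smul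
    (c / ((G.vol.real univ ^ (-(1 / 2) : ℝ) : ℝ) : ℂ)) G.unitConst] with x h1 h2 h3
  rw [h3, Pi.smul_apply, h2, h1, smul_eq_mul, div_mul_cancel₀ _ unitConst_value_ne_zero]

variable (G) in
theorem exists_isDiagonalIn_H₀ [Finite V] [Nonempty E] (hG : G.Connected) :
    ∃ (lam : ℕ → ℝ) (b : HilbertBasis ℕ ℂ G.L2), IsDiagonalIn G.H₀ lam b ∧ lam 0 = 0 ∧
      (∀ n, 0 < lam (n + 1)) ∧ Monotone lam ∧ Tendsto lam atTop atTop ∧ b 0 = G.unitConst := by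
  refine exists_isDiagonalIn G.not_finiteDimensional_L2 G.norm_unitConst
    (G.const_mem_graph _ G.coeFn_unitConst) (fun f h f' h' => G.graph_symmetric)
    (fun f h => G.graph_nonneg) (fun f hf => ?_) (fun h hh => ?_) G.exists_isCompact_of_graph
  · obtain ⟨c, hf⟩ := (G.mem_graph_zero_iff hG).1 hf
    exact mem_span_unitConst hf
  · refine G.exists_mem_graph hG h ?_
    rw [G.inner_eq_sum _ _ G.coeFn_unitConst (ae_eq_refl _)] at hh
    simp only [intervalIntegral.integral_const_mul, ← Finset.mul_sum] at hh
    exact (mul_eq_zero.1 hh).resolve_left (by simpa using unitConst_value_ne_zero)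

end QuantumGraph

namespace QuantumGraph

variable {V E : Type*} {G : QuantumGraph V E} [Fintype E]

/-! ## Bounds for the eigenfunctions -/

theorem norm_sq_le_of_mem_graph [Finite V] {f h : G.L2} (hfh : (f, h) ∈ G.H₀.graph)
    {u : C(G.Space, ℂ)} (hf : f =ᵐ[G.vol] u) (x : G.Space) {ε : ℝ} (hε : 0 < ε) :
    ‖u x‖ ^ 2 ≤ ((∑ e, (G.len e)⁻¹) + ε) * ‖f‖ ^ 2 + ε⁻¹ * (inner ℂ h f).re := by
  obtain ⟨v, dv, hfv, hv⟩ := G.exists_rep hfh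
  rw [G.eq_of_ae_eq (hf.symm.trans hfv)]
  exact hv.norm_sq_le hfv x hε

/-- `Φ n` is the continuous version of the `n`-th eigenfunction `b n` of `H₀`. -/
structure IsEigenSystem (G : QuantumGraph V E) (lam : ℕ → ℝ) (b : HilbertBasis ℕ ℂ G.L2)
    (Φ : ℕ → C(G.Space, ℂ)) : Prop where
  diagonal : IsDiagonalIn G.H₀ lam b
  nonneg : ∀ n, 0 ≤ lam n
  version : ∀ n, b n =ᵐ[G.vol] Φ n

variable {lam : ℕ → ℝ} {b : HilbertBasis ℕ ℂ G.L2} {Φ : ℕ → C(G.Space, ℂ)}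

theorem IsEigenSystem.toLp_eq (hΦ : G.IsEigenSystem lam b Φ) (n : ℕ) :
    ContinuousMap.toLp 2 G.vol ℂ (Φ n) = b n :=
  Lp.ext ((ContinuousMap.coeFn_toLp (p := 2) (𝕜 := ℂ) G.vol _).trans (hΦ.version n).symm)

/-- The Sobolev inequality for a finite combination of eigenfunctions: orthonormality makes both the
norm and the energy diagonal sums. -/
theorem IsEigenSystem.norm_sq_sum_le [Finite V] (hΦ : G.IsEigenSystem lam b Φ) (s : Finset ℕ)
    (c : ℕ → ℂ) (x : G.Space) {ε : ℝ} (hε : 0 < ε) :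
    ‖∑ n ∈ s, c n * Φ n x‖ ^ 2 ≤ ((∑ e, (G.len e)⁻¹) + ε) * ∑ n ∈ s, ‖c n‖ ^ 2 +
      ε⁻¹ * ∑ n ∈ s, lam n * ‖c n‖ ^ 2 := by
  have hgraph : (∑ n ∈ s, c n • b n, ∑ n ∈ s, c n • (lam n : ℂ) • b n) ∈ G.H₀.graph := by
    have := G.H₀.graph.sum_mem (t := s) fun n _ =>
      G.H₀.graph.smul_mem (c n) (hΦ.diagonal.basis_mem_graph n)
    rwa [← prod_mk_sum] at this
  have hver : (∑ n ∈ s, c n • b n : G.L2) =ᵐ[G.vol] (∑ n ∈ s, c n • Φ n : C(G.Space, ℂ)) := by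
    have h1 : ContinuousMap.toLp 2 G.vol ℂ (∑ n ∈ s, c n • Φ n) = ∑ n ∈ s, c n • b n := by
      simp only [map_sum, map_smul, hΦ.toLp_eq]
    rw [← h1]
    exact ContinuousMap.coeFn_toLp (p := 2) (𝕜 := ℂ) G.vol _
  have h1 := norm_sq_le_of_mem_graph hgraph hver x hε
  have h2 : ‖∑ n ∈ s, c n • b n‖ ^ 2 = ∑ n ∈ s, ‖c n‖ ^ 2 := by
    have := b.orthonormal.inner_sum c c s
    rw [inner_self_eq_norm_sq_to_K] at this
    refine Complex.ofReal_injective ?_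
    rw [Complex.ofReal_pow, Complex.ofReal_sum]
    refine this.trans (Finset.sum_congr rfl fun n _ => ?_)
    rw [← Complex.normSq_eq_conj_mul_self, Complex.normSq_eq_norm_sq]
  have h3 : (inner ℂ (∑ n ∈ s, c n • (lam n : ℂ) • b n) (∑ n ∈ s, c n • b n)).re =
      ∑ n ∈ s, lam n * ‖c n‖ ^ 2 := by
    have := b.orthonormal.inner_sum (fun n => c n * lam n) c s
    simp only [smul_smul, this]
    rw [Complex.re_sum]
    refine Finset.sum_congr rfl fun n _ => ?_
    have : starRingEnd ℂ (c n * lam n) * c n = ((lam n * ‖c n‖ ^ 2 : ℝ) : ℂ) := by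
      rw [map_mul, Complex.conj_ofReal, mul_right_comm, ← Complex.normSq_eq_conj_mul_self,
        Complex.normSq_eq_norm_sq, ← Complex.ofReal_mul, mul_comm]
    rw [this, Complex.ofReal_re]
  rw [h2, h3] at h1
  simpa using h1

theorem mul_exp_neg_le_one (x : ℝ) : x * Real.exp (-x) ≤ 1 := by
  rw [Real.exp_neg, ← div_eq_mul_inv, div_le_one (Real.exp_pos x)]
  linarith [Real.add_one_le_exp x]

/-- Take the coefficients `exp (-λₙ t)` times the conjugate of `Φ n x`. The combination at `x` is
then the sum `S` itself, its norm squared is at most `S`, and its energy is at most `t⁻¹ S` because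
`y exp (-y) ≤ 1`. Hence `S²` is at most the bound times `S`. -/
theorem IsEigenSystem.sum_exp_le [Finite V] (hΦ : G.IsEigenSystem lam b Φ) (s : Finset ℕ)
    (x : G.Space) {t ε : ℝ} (ht : 0 < t) (hε : 0 < ε) :
    ∑ n ∈ s, Real.exp (-(lam n * t)) * ‖Φ n x‖ ^ 2 ≤ (∑ e, (G.len e)⁻¹) + ε + ε⁻¹ * t⁻¹ := by
  set S := ∑ n ∈ s, Real.exp (-(lam n * t)) * ‖Φ n x‖ ^ 2 with hS
  have hS0 : 0 ≤ S := Finset.sum_nonneg fun n _ => by positivity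
  have hC0 : 0 ≤ ∑ e, (G.len e)⁻¹ := Finset.sum_nonneg fun e _ => (inv_pos.2 (G.len_pos e)).le
  have h1 := hΦ.norm_sq_sum_le s
    (fun n => (Real.exp (-(lam n * t)) : ℂ) * starRingEnd ℂ (Φ n x)) x hε
  have h2 : ∑ n ∈ s, (Real.exp (-(lam n * t)) : ℂ) * starRingEnd ℂ (Φ n x) * Φ n x = (S : ℂ) := by
    rw [hS, Complex.ofReal_sum]
    refine Finset.sum_congr rfl fun n _ => ?_
    rw [mul_assoc, ← Complex.normSq_eq_conj_mul_self, Complex.normSq_eq_norm_sq,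
      ← Complex.ofReal_mul]
  have h3 : ∀ n, ‖(Real.exp (-(lam n * t)) : ℂ) * starRingEnd ℂ (Φ n x)‖ ^ 2 =
      Real.exp (-(lam n * t)) * (Real.exp (-(lam n * t)) * ‖Φ n x‖ ^ 2) := fun n => by
    rw [norm_mul, Complex.norm_real, RCLike.norm_conj, Real.norm_eq_abs, Real.abs_exp]
    ring
  simp only [h3] at h1
  rw [h2, Complex.norm_real, Real.norm_of_nonneg hS0] at h1
  have h4 : ∑ n ∈ s, Real.exp (-(lam n * t)) * (Real.exp (-(lam n * t)) * ‖Φ n x‖ ^ 2) ≤ S := by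
    refine Finset.sum_le_sum fun n _ => mul_le_of_le_one_left (by positivity) ?_
    rw [Real.exp_le_one_iff, neg_nonpos]
    exact mul_nonneg (hΦ.nonneg n) ht.le
  have h5 : ∑ n ∈ s, lam n * (Real.exp (-(lam n * t)) *
      (Real.exp (-(lam n * t)) * ‖Φ n x‖ ^ 2)) ≤ t⁻¹ * S := by
    rw [hS, Finset.mul_sum]
    refine Finset.sum_le_sum fun n _ => ?_
    rw [← mul_assoc]
    refine mul_le_mul_of_nonneg_right ?_ (by positivity)
    rw [← mul_one t⁻¹, le_inv_mul_iff₀ ht, ← mul_assoc, mul_comm t]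
    exact mul_exp_neg_le_one _
  have h6 : S ^ 2 ≤ ((∑ e, (G.len e)⁻¹) + ε + ε⁻¹ * t⁻¹) * S := by
    refine h1.trans ?_
    rw [add_mul _ (ε⁻¹ * t⁻¹), mul_assoc ε⁻¹]
    gcongr
  by_contra! hlt
  have hpos : 0 < S := lt_of_le_of_lt (by positivity) hlt
  nlinarith

/-- The trace of the heat semigroup is finite: integrate the pointwise bound over the graph, where
each `‖Φ n‖²` has integral one. -/
theorem IsEigenSystem.summable_exp [Finite V] (hΦ : G.IsEigenSystem lam b Φ) {t : ℝ} (ht : 0 < t) :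
    Summable fun n => Real.exp (-(lam n * t)) := by
  set B := (∑ e, (G.len e)⁻¹) + 1 + 1⁻¹ * t⁻¹
  refine summable_of_sum_le (c := ∑ e, G.len e * B) (fun n => (Real.exp_pos _).le) fun s => ?_
  have hcont : ∀ n e, Continuous fun r => ‖Φ n (G.pt e r)‖ ^ 2 := fun n e =>
    ((Φ n).continuous.comp (G.continuous_pt e)).norm.pow 2
  have h1 : ∀ n, Real.exp (-(lam n * t)) = ∑ e, ∫ r in (0 : ℝ)..G.len e,
      Real.exp (-(lam n * t)) * ‖Φ n (G.pt e r)‖ ^ 2 := fun n => by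
    simp only [intervalIntegral.integral_const_mul, ← Finset.mul_sum]
    rw [← G.norm_sq_eq_sum (b n) (hΦ.version n), b.orthonormal.1 n, one_pow, mul_one]
  rw [Finset.sum_congr rfl fun n _ => h1 n, Finset.sum_comm]
  refine Finset.sum_le_sum fun e _ => ?_
  rw [← intervalIntegral.integral_finsetSum
    (f := fun n r => Real.exp (-(lam n * t)) * ‖Φ n (G.pt e r)‖ ^ 2) fun n _ =>
      (continuous_const.mul (hcont n e)).intervalIntegrable _ _]
  refine (intervalIntegral.integral_mono_on (g := fun _ => B) (G.len_pos e).le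
    (Continuous.intervalIntegrable (continuous_finsetSum _ fun n _ =>
      continuous_const.mul (hcont n e)) _ _)
    intervalIntegrable_const fun r _ => hΦ.sum_exp_le s (G.pt e r) ht one_pos).trans_eq ?_
  rw [intervalIntegral.integral_const, smul_eq_mul, sub_zero]

/-- The terms `e^{-λₙ t} ‖Φ n‖²` have a summable bound that is uniform in `t ≥ t₀ > 0`. -/
theorem IsEigenSystem.exists_summable_bound [Finite V] [Nonempty E]
    (hΦ : G.IsEigenSystem lam b Φ) {t₀ : ℝ} (ht₀ : 0 < t₀) :
    ∃ B : ℕ → ℝ, Summable B ∧ ∀ n, ∀ t, t₀ ≤ t →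
      Real.exp (-(lam n * t)) * ‖Φ n‖ ^ 2 ≤ B n := by
  -- Half of the time `t₀` pays for the sup norm of `Φ n`; the other half remains for summability.
  set B := (∑ e, (G.len e)⁻¹) + 1 + 1⁻¹ * (t₀ / 2)⁻¹
  refine ⟨fun n => B * Real.exp (-(lam n * (t₀ / 2))),
    (hΦ.summable_exp (half_pos ht₀)).mul_left B, fun n t ht => ?_⟩
  have h1 : ∀ x, ‖Φ n x‖ ≤ Real.sqrt (B * Real.exp (lam n * (t₀ / 2))) := fun x => by
    refine Real.le_sqrt_of_sq_le ?_
    have h2 := hΦ.sum_exp_le {n} x (half_pos ht₀) one_pos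
    rw [Finset.sum_singleton, Real.exp_neg, inv_mul_le_iff₀ (Real.exp_pos _)] at h2
    rwa [mul_comm] at h2
  have h2 := (ContinuousMap.norm_le_of_nonempty (Φ n)).2 h1
  have h3 : 0 ≤ B := by
    have hC0 : 0 ≤ ∑ e, (G.len e)⁻¹ := Finset.sum_nonneg fun e _ => (inv_pos.2 (G.len_pos e)).le
    positivity
  have h4 : ‖Φ n‖ ^ 2 ≤ B * Real.exp (lam n * (t₀ / 2)) := by
    rw [← Real.sq_sqrt (by positivity : 0 ≤ B * Real.exp (lam n * (t₀ / 2)))]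
    gcongr
  calc Real.exp (-(lam n * t)) * ‖Φ n‖ ^ 2
      ≤ Real.exp (-(lam n * t₀)) * (B * Real.exp (lam n * (t₀ / 2))) := by
        have := hΦ.nonneg n
        gcongr
    _ = B * Real.exp (-(lam n * (t₀ / 2))) := by
        rw [mul_left_comm, ← Real.exp_add]
        ring_nf

/-! ## The heat kernel -/

/-- The expansion of the heat kernel in eigenfunctions. -/
def heatSum (lam : ℕ → ℝ) (Φ : ℕ → C(G.Space, ℂ)) (t : ℝ) (x y : G.Space) : ℂ :=
  ∑' n, (Real.exp (-(lam n * t)) : ℂ) * (Φ n x * starRingEnd ℂ (Φ n y))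

theorem norm_heatSum_term_le (n : ℕ) (t : ℝ) (x y : G.Space) :
    ‖(Real.exp (-(lam n * t)) : ℂ) * (Φ n x * starRingEnd ℂ (Φ n y))‖ ≤
      Real.exp (-(lam n * t)) * ‖Φ n‖ ^ 2 := by
  rw [norm_mul, norm_mul, Complex.norm_real, RCLike.norm_conj, Real.norm_eq_abs, Real.abs_exp, sq]
  gcongr
  · exact (Φ n).norm_coe_le_norm x
  · exact (Φ n).norm_coe_le_norm y

theorem IsEigenSystem.hasSum_heatSum [Finite V] [Nonempty E] (hΦ : G.IsEigenSystem lam b Φ)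
    {t : ℝ} (ht : 0 < t) (x y : G.Space) :
    HasSum (fun n => (Real.exp (-(lam n * t)) : ℂ) * (Φ n x * starRingEnd ℂ (Φ n y)))
      (heatSum lam Φ t x y) := by
  obtain ⟨B, hB, hle⟩ := hΦ.exists_summable_bound ht
  exact (Summable.of_norm_bounded hB fun n =>
    (norm_heatSum_term_le n t x y).trans (hle n t le_rfl)).hasSum

theorem IsEigenSystem.continuousOn_heatSum [Finite V] [Nonempty E]
    (hΦ : G.IsEigenSystem lam b Φ) :
    ContinuousOn (fun p : ℝ × G.Space × G.Space => heatSum lam Φ p.1 p.2.1 p.2.2)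
      (Ioi 0 ×ˢ univ) := by
  rintro ⟨t, x, y⟩ ⟨ht, -⟩
  have ht : 0 < t := ht
  obtain ⟨B, hB, hle⟩ := hΦ.exists_summable_bound (half_pos ht)
  have h1 : ContinuousOn (fun p : ℝ × G.Space × G.Space => heatSum lam Φ p.1 p.2.1 p.2.2)
      (Ioi (t / 2) ×ˢ univ) := by
    refine continuousOn_tsum (fun n => Continuous.continuousOn ?_) hB fun n p hp =>
      (norm_heatSum_term_le n _ _ _).trans (hle n _ (le_of_lt hp.1))
    have h2 : Continuous fun p : ℝ × G.Space × G.Space => starRingEnd ℂ (Φ n p.2.2) :=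
      Complex.continuous_conj.comp (by fun_prop)
    fun_prop
  refine (h1.continuousAt ?_).continuousWithinAt
  exact (isOpen_Ioi.prod isOpen_univ).mem_nhds ⟨by simpa using ht, trivial⟩

/-- The eigenfunction series of the semigroup applied to `f` converges in sup norm, so its limit is
a continuous version; the same summable bound allows exchanging sum and integral. -/
theorem IsEigenSystem.expNeg_eq_integral [Finite V] [Nonempty E] (hΦ : G.IsEigenSystem lam b Φ)
    {t : ℝ} (ht : 0 < t) (f : G.L2) :
    b.expNeg lam hΦ.nonneg t f =ᵐ[G.vol] fun x => ∫ y, heatSum lam Φ t x y * f y ∂G.vol := by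
  obtain ⟨B, hB, hle⟩ := hΦ.exists_summable_bound ht
  have hsum := hΦ.summable_exp ht
  let c : ℕ → ℂ := fun n => b.repr (b.expNeg lam hΦ.nonneg t f) n
  have hc : ∀ n, c n = Real.exp (-(lam n * t)) * b.repr f n := fun n =>
    b.repr_expNeg lam hΦ.nonneg ht.le f n
  have hnorm : ∀ n, ‖c n • Φ n‖ ≤ (Real.exp (-(lam n * t)) + B n) * ‖f‖ := fun n => by
    have h1 : ‖b.repr f n‖ ≤ ‖f‖ := by
      rw [b.repr_apply_apply]
      simpa [b.orthonormal.1 n] using norm_inner_le_norm (𝕜 := ℂ) (b n) f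
    have h2 : ‖Φ n‖ ≤ 1 + ‖Φ n‖ ^ 2 := by nlinarith [sq_nonneg (‖Φ n‖ - 1)]
    rw [norm_smul, hc, norm_mul, Complex.norm_real, Real.norm_eq_abs, Real.abs_exp,
      mul_right_comm]
    refine mul_le_mul ?_ h1 (norm_nonneg _) ?_
    · refine (mul_le_mul_of_nonneg_left h2 (Real.exp_pos _).le).trans ?_
      rw [mul_add, mul_one]
      exact add_le_add_right (hle n t le_rfl) _
    · have := (le_trans (by positivity) (hle n t le_rfl) : 0 ≤ B n)
      positivity
  have hU : HasSum (fun n => c n • Φ n) (∑' n, c n • Φ n) :=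
    (Summable.of_norm_bounded ((hsum.add hB).mul_right ‖f‖) hnorm).hasSum
  set U := ∑' n, c n • Φ n
  have h1 : ContinuousMap.toLp 2 G.vol ℂ U = b.expNeg lam hΦ.nonneg t f := by
    have h2 := hU.mapL (ContinuousMap.toLp 2 G.vol ℂ)
    simp only [map_smul, hΦ.toLp_eq] at h2
    exact h2.unique (b.hasSum_repr _)
  rw [← h1]
  refine (ContinuousMap.coeFn_toLp (p := 2) (𝕜 := ℂ) G.vol U).trans (Eventually.of_forall fun x => ?_)
  have hfint : Integrable f G.vol := (Lp.memLp f).integrable (by norm_num)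
  have hterm : ∀ n, Integrable (fun y =>
      (Real.exp (-(lam n * t)) : ℂ) * (Φ n x * starRingEnd ℂ (Φ n y)) * f y) G.vol := fun n => by
    refine hfint.bdd_mul (c := Real.exp (-(lam n * t)) * ‖Φ n‖ ^ 2) ?_
      (Eventually.of_forall fun y => norm_heatSum_term_le n t x y)
    have h2 : Continuous fun y => starRingEnd ℂ (Φ n y) :=
      Complex.continuous_conj.comp (Φ n).continuous
    exact (by fun_prop : Continuous fun y =>
      (Real.exp (-(lam n * t)) : ℂ) * (Φ n x * starRingEnd ℂ (Φ n y))).aestronglyMeasurable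
  have h3 := hasSum_integral_of_summable_integral_norm hterm (by
    refine Summable.of_nonneg_of_le (fun n => integral_nonneg fun y => norm_nonneg _) (fun n => ?_)
      (hB.mul_right (∫ y, ‖f y‖ ∂G.vol))
    rw [← integral_const_mul]
    refine integral_mono (hterm n).norm (hfint.norm.const_mul _) fun y => ?_
    rw [norm_mul]
    exact mul_le_mul_of_nonneg_right ((norm_heatSum_term_le n t x y).trans (hle n t le_rfl))
      (norm_nonneg _))
  have h4 : ∀ n, ∫ y, (Real.exp (-(lam n * t)) : ℂ) * (Φ n x * starRingEnd ℂ (Φ n y)) * f y ∂G.vol =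
      c n * Φ n x := fun n => by
    rw [hc, b.repr_apply_apply, L2.inner_def, ← integral_const_mul, ← integral_mul_const]
    refine integral_congr_ae ?_
    filter_upwards [hΦ.version n] with y hy
    rw [hy, RCLike.inner_apply]
    ring
  simp only [h4] at h3
  have h5 : HasSum (fun n => c n * Φ n x) (U x) := by
    have := hU.mapL (ContinuousMap.evalCLM ℂ x)
    simpa using this
  rw [h5.unique h3]
  refine integral_congr_ae (Eventually.of_forall fun y => ?_)
  simp only
  rw [heatSum, tsum_mul_right]

/-- If the kernel were negative at `(x, y)`, it would be so on a product `U × W` of open sets, and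
the semigroup applied to the indicator of `W` would be negative on `U`. Requiring only `0 ≤ l 1`
admits the imaginary part and its negative, so that reality of the kernel comes from the same
argument. -/
theorem IsEigenSystem.apply_heatSum_nonneg [Finite V] [Nonempty E] (hΦ : G.IsEigenSystem lam b Φ)
    (l : ℂ →L[ℝ] ℝ) (hl : 0 ≤ l 1) {t : ℝ} (ht : 0 < t) (x y : G.Space) :
    0 ≤ l (heatSum lam Φ t x y) := by
  by_contra! hneg
  have hcont : Continuous fun p : G.Space × G.Space => heatSum lam Φ t p.1 p.2 :=
    hΦ.continuousOn_heatSum.comp_continuous (f := fun p : G.Space × G.Space => (t, p))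
      (by fun_prop) fun p => ⟨ht, trivial⟩
  set m := l (heatSum lam Φ t x y) with hm
  have hnear : ∀ᶠ p : G.Space × G.Space in 𝓝 (x, y), l (heatSum lam Φ t p.1 p.2) < m / 2 := by
    refine (l.continuous.comp hcont).continuousAt.eventually_lt continuousAt_const ?_
    simp only [Function.comp_apply, ← hm]
    linarith
  rw [nhds_prod_eq, Filter.eventually_prod_iff] at hnear
  obtain ⟨p, hp, q, hq, hpq⟩ := hnear
  obtain ⟨U, hUp, hU, hxU⟩ := eventually_nhds_iff.1 hp
  obtain ⟨W, hWq, hW, hyW⟩ := eventually_nhds_iff.1 hq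
  let f : G.L2 := indicatorConstLp 2 hW.measurableSet (measure_ne_top G.vol W) (1 : ℂ)
  have hf : f =ᵐ[G.vol] W.indicator fun _ => (1 : ℂ) := indicatorConstLp_coeFn
  have hfl : f ∈ G.nonnegSet l := by
    change ∀ᵐ z ∂G.vol, 0 ≤ l (f z)
    filter_upwards [hf] with z hz
    rw [hz]
    by_cases h : z ∈ W <;> simp [h, hl]
  have hTf := hΦ.diagonal.expNeg_mem hΦ.nonneg (G.isClosed_nonnegSet l)
    (fun a ha g g' hg' => G.mem_nonnegSet_of_resolvent l ha hg') ht hfl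
  have hint : ∀ z, IntegrableOn (fun w => heatSum lam Φ t z w) W G.vol := fun z =>
    ((hcont.comp (by fun_prop : Continuous fun w => (z, w))).integrable_of_hasCompactSupport
      (HasCompactSupport.of_compactSpace _)).integrableOn
  have hWpos : 0 < G.vol.real W := by
    rw [measureReal_def]
    exact ENNReal.toReal_pos (hW.measure_pos G.vol ⟨y, hyW⟩).ne' (measure_ne_top _ _)
  have hbad : ∀ᵐ z ∂G.vol, z ∉ U := by
    have hTf' : ∀ᵐ z ∂G.vol, 0 ≤ l (b.expNeg lam hΦ.nonneg t f z) := hTf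
    filter_upwards [hTf', hΦ.expNeg_eq_integral ht f] with z h1 h2 hzU
    have h3 : ∫ w, heatSum lam Φ t z w * f w ∂G.vol = ∫ w in W, heatSum lam Φ t z w ∂G.vol := by
      rw [← integral_indicator hW.measurableSet]
      refine integral_congr_ae ?_
      filter_upwards [hf] with w hw
      rw [hw]
      by_cases h : w ∈ W <;> simp [h]
    rw [h2, h3, ← ContinuousLinearMap.integral_comp_comm l (hint z)] at h1
    have h4 : ∫ w in W, l (heatSum lam Φ t z w) ∂G.vol ≤ ∫ _ in W, m / 2 ∂G.vol :=
      setIntegral_mono_on (l.integrable_comp (hint z)) (integrable_const _) hW.measurableSet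
        fun w hw => (hpq (hUp z hzU) (hWq w hw)).le
    rw [setIntegral_const, smul_eq_mul] at h4
    have h5 := mul_neg_of_pos_of_neg hWpos (by linarith : m / 2 < 0)
    linarith
  have h0 : G.vol U = 0 := by
    have := hbad
    rw [ae_iff] at this
    simpa using this
  exact (hU.measure_pos G.vol ⟨x, hxU⟩).ne' h0

end QuantumGraph

/-! ### Reality, positivity and diagonal bound of the kernel; the zero eigenspace; conclusion -/

namespace QuantumGraph

variable {V E : Type*} {G : QuantumGraph V E} [Fintype E]
variable {lam : ℕ → ℝ} {b : HilbertBasis ℕ ℂ G.L2} {Φ : ℕ → C(G.Space, ℂ)}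

theorem exists_isEigenSystem (hd : IsDiagonalIn G.H₀ lam b) (hlam : ∀ n, 0 ≤ lam n) :
    ∃ Φ, G.IsEigenSystem lam b Φ := by
  have h1 : ∀ n, ∃ u : C(G.Space, ℂ), b n =ᵐ[G.vol] u := fun n => by
    obtain ⟨u, _, hu, _⟩ := G.exists_rep (hd.basis_mem_graph n)
    exact ⟨u, hu⟩
  choose Φ hΦ using h1
  exact ⟨Φ, hd, hlam, hΦ⟩

theorem IsEigenSystem.re_heatSum_nonneg [Finite V] [Nonempty E] (hΦ : G.IsEigenSystem lam b Φ)
    {t : ℝ} (ht : 0 < t) (x y : G.Space) : 0 ≤ (heatSum lam Φ t x y).re :=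
  hΦ.apply_heatSum_nonneg Complex.reCLM (by simp) ht x y

theorem IsEigenSystem.ofReal_re_heatSum [Finite V] [Nonempty E] (hΦ : G.IsEigenSystem lam b Φ)
    {t : ℝ} (ht : 0 < t) (x y : G.Space) :
    ((heatSum lam Φ t x y).re : ℂ) = heatSum lam Φ t x y := by
  have h1 := hΦ.apply_heatSum_nonneg Complex.imCLM (by simp) ht x y
  have h2 := hΦ.apply_heatSum_nonneg (-Complex.imCLM) (by simp) ht x y
  simp only [_root_.neg_apply, Complex.imCLM_apply] at h1 h2
  exact Complex.ext rfl (by rw [Complex.ofReal_im]; linarith)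

/-- The choice `ε = t ^ (-1/2)` balances `ε` against `ε⁻¹ t⁻¹`; for `t < 1` also `ε ≥ 1`, so the
constant term is absorbed. -/
theorem IsEigenSystem.re_heatSum_diag_le [Finite V] [Nonempty E] (hΦ : G.IsEigenSystem lam b Φ)
    {t : ℝ} (ht : t ∈ Ioo (0 : ℝ) 1) (x : G.Space) :
    (heatSum lam Φ t x x).re ≤ ((∑ e, (G.len e)⁻¹) + 2) * t ^ (-(1 / 2) : ℝ) := by
  have hC0 : 0 ≤ ∑ e, (G.len e)⁻¹ := Finset.sum_nonneg fun e _ => (inv_pos.2 (G.len_pos e)).le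
  set ε := t ^ (-(1 / 2) : ℝ) with hε
  have hε0 : 0 < ε := Real.rpow_pos_of_pos ht.1 _
  have hε1 : 1 ≤ ε := Real.one_le_rpow_of_pos_of_le_one_of_nonpos ht.1 ht.2.le (by norm_num)
  have hε2 : ε⁻¹ * t⁻¹ = ε := by
    rw [hε, ← Real.rpow_neg ht.1.le, ← Real.rpow_neg_one t, ← Real.rpow_add ht.1]
    norm_num
  have h1 := Complex.hasSum_re (hΦ.hasSum_heatSum ht.1 x x)
  refine hasSum_le_of_sum_le h1 fun s => ?_
  have h2 : ∀ n, ((Real.exp (-(lam n * t)) : ℂ) * (Φ n x * starRingEnd ℂ (Φ n x))).re =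
      Real.exp (-(lam n * t)) * ‖Φ n x‖ ^ 2 := fun n => by
    rw [mul_comm (Φ n x), ← Complex.normSq_eq_conj_mul_self, Complex.normSq_eq_norm_sq,
      ← Complex.ofReal_mul, Complex.ofReal_re]
  simp only [h2]
  refine (hΦ.sum_exp_le s x ht.1 hε0).trans ?_
  rw [hε2]
  nlinarith [mul_le_mul_of_nonneg_left hε1 hC0]

theorem IsEigenSystem.isHeatKernel [Finite V] [Nonempty E] (hΦ : G.IsEigenSystem lam b Φ) :
    IsHeatKernel G.vol G.H₀ fun t x y => (heatSum lam Φ t x y).re := by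
  refine ⟨b.expNeg lam hΦ.nonneg, hΦ.diagonal.isSemigroup hΦ.nonneg, fun t ht f => ?_⟩
  simp only [hΦ.ofReal_re_heatSum ht]
  exact hΦ.expNeg_eq_integral ht f

variable (G) in
theorem mem_eigenspaceOf_zero_iff [Finite V] [Nonempty E] (hG : G.Connected) (f : G.L2) :
    f ∈ eigenspaceOf G.H₀ 0 ↔ ∃ c : ℂ, f =ᵐ[G.vol] fun _ => c := by
  have : f ∈ eigenspaceOf G.H₀ 0 ↔ (f, (0 : ℂ) • f) ∈ G.H₀.graph := Iff.rfl
  rw [this, zero_smul, G.mem_graph_zero_iff hG]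

variable (G) in
theorem finrank_eigenspaceOf_zero [Finite V] [Nonempty E] (hG : G.Connected) :
    Module.finrank ℂ (eigenspaceOf G.H₀ 0) = 1 := by
  have hne : G.unitConst ≠ 0 := fun h => by
    have := norm_unitConst (G := G)
    simp [h] at this
  have : eigenspaceOf G.H₀ 0 = Submodule.span ℂ {G.unitConst} := by
    refine le_antisymm (fun f hf => ?_) ?_
    · obtain ⟨c, hc⟩ := (G.mem_eigenspaceOf_zero_iff hG f).1 hf
      exact mem_span_unitConst hc
    · rw [Submodule.span_singleton_le_iff_mem]
      exact (G.mem_eigenspaceOf_zero_iff hG _).2 ⟨_, G.coeFn_unitConst⟩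
  rw [this, finrank_span_singleton hne]

end QuantumGraph

theorem mainTheorem8 {V E : Type*} [Finite V] [Fintype E] [Nonempty E]
    (G : QuantumGraph V E) (hG : G.Connected) :
    -- `H₀` is a non-negative self-adjoint operator with discrete spectrum
    IsSelfAdjoint G.H₀ ∧
    (∀ f : G.H₀.domain, ∃ r : ℝ, 0 ≤ r ∧ inner ℂ (f : G.L2) (G.H₀ f) = (r : ℂ)) ∧
    (∃ (lam : ℕ → ℝ) (φ : HilbertBasis ℕ ℂ G.L2), IsDiscreteSpectrum G.H₀ lam φ ∧
      -- (H4), in terms of the list of eigenvalues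
      lam 0 = 0 ∧ 0 < lam 1 ∧
      φ 0 =ᵐ[G.vol] fun _ => ((G.vol.real univ ^ (-(1 / 2) : ℝ) : ℝ) : ℂ)) ∧
    -- (H4), in terms of eigenspaces
    ((∀ z : ℂ, eigenspaceOf G.H₀ z ≠ ⊥ → ∃ r : ℝ, 0 ≤ r ∧ z = (r : ℂ)) ∧
      Module.finrank ℂ (eigenspaceOf G.H₀ 0) = 1 ∧
      ∀ f : G.L2, f ∈ eigenspaceOf G.H₀ 0 ↔ ∃ c : ℂ, f =ᵐ[G.vol] fun _ => c) ∧
    -- (H1) and, with `d = 1`, (H2)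
    ∃ K : ℝ → G.Space → G.Space → ℝ, IsHeatKernel G.vol G.H₀ K ∧
      ContinuousOn (fun p : ℝ × G.Space × G.Space => K p.1 p.2.1 p.2.2) (Ioi 0 ×ˢ univ) ∧
      (∀ t : ℝ, 0 < t → ∀ x y : G.Space, 0 ≤ K t x y) ∧
      ∃ c : ℝ, 0 < c ∧ ∀ t ∈ Ioo (0 : ℝ) 1, ∀ x : G.Space,
        0 ≤ K t x x ∧ K t x x ≤ c * t ^ (-(1 / 2) : ℝ) := by
  obtain ⟨lam, b, hd, h0, hpos, hmono, htend, hb0⟩ := G.exists_isDiagonalIn_H₀ hG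
  have hlam : ∀ n, 0 ≤ lam n := fun n => h0 ▸ hmono (Nat.zero_le n)
  obtain ⟨Φ, hΦ⟩ := QuantumGraph.exists_isEigenSystem hd hlam
  refine ⟨hd.isSelfAdjoint, hd.inner_nonneg hlam, ⟨lam, b, ⟨hmono, htend,
    hd.mem_eigenspaceOf_basis⟩, h0, hpos 0, ?_⟩, ⟨hd.eigenvalue_nonneg hlam,
    G.finrank_eigenspaceOf_zero hG, G.mem_eigenspaceOf_zero_iff hG⟩,
    fun t x y => (QuantumGraph.heatSum lam Φ t x y).re, hΦ.isHeatKernel,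
    Complex.continuous_re.comp_continuousOn hΦ.continuousOn_heatSum,
    fun t ht x y => hΦ.re_heatSum_nonneg ht x y, (∑ e, (G.len e)⁻¹) + 2, ?_, fun t ht x =>
    ⟨hΦ.re_heatSum_nonneg ht.1 x x, hΦ.re_heatSum_diag_le ht x⟩⟩
  · rw [hb0]
    exact G.coeFn_unitConst
  · have : 0 ≤ ∑ e, (G.len e)⁻¹ := Finset.sum_nonneg fun e _ => (inv_pos.2 (G.len_pos e)).le
    linarith

end
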